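/- Let $q\ge 2$ and $p\ge 1$ be fixed integers, and set $\varepsilon_p=\frac{q-2}{(q-1)^p-1}$ if $q>2$ and $\varepsilon_p=1/p$ if $q=2$. For each $n\ge1$ let $\lambda_n>0$ and consider the spiked tensor model $$Y=\frac{\lambda_n}{n^{q/2}}\,u^{\otimes q}+\frac1{\sqrt n}\,W\in(\mathbb R^n)^{\otimes q},$$ where $u\sim\mathrm{Unif}(\{+1,-1\}^n)$ and $W$ has i.i.d. $\mathcal N(0,1)$ entries. Tensor power iteration is started at $\hat u_0\sim\mathrm{Unif}(\mathbb S^{n-1})$, where $u$, $W$, $\hat u_0$ are independent, and is given by $$\hat u_k=\sqrt n\,\frac{Y[\hat u_{k-1}^{\otimes(q-1)}]}{\big\|Y[\hat u_{k-1}^{\otimes(q-1)}]\big\|_2},\qquad k\ge1,$$ where $Y[x^{\otimes(q-1)}]\in\mathbb R^n$ is the contraction of the last $q-1$ slots of $Y$ with $x$. Suppose that $$\lim_{n\to\infty}\frac{\lambda_n}{n^{(q-2+\varepsilon_p)/2}}=\Lambda\in\mathbb R.$$ Then the overlap $\mathcal R_{\rm PI}=\hat u_p^\top u/n$ of the $p$-step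 power iteration converges in distribution as $n\to\infty$: $$\mathcal R_{\rm PI}\ \stackrel{d}{\longrightarrow}\ \sin\big[\arctan\big(\Lambda^{1/\varepsilon_p}\,G^{(q-1)^p}\big)\big],\qquad G\sim\mathcal N(0,1).$$ -/

import Mathlib

open MeasureTheory ProbabilityTheory Filter Topology

noncomputable section

namespace SpikedTensor

/-- Real tensors of order `q` on `ℝⁿ`. -/
abbrev Tensor (n q : ℕ) : Type := (Fin q → Fin n) → ℝ

/-- The uniform distribution on the hypercube `{+1, -1}ⁿ`. -/
def uniformCube (n : ℕ) : Measure (EuclideanSpace ℝ (Fin n)) :=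
  uniformOn {u | ∀ i, u i = 1 ∨ u i = -1}

/-- The law of a tensor with i.i.d. standard Gaussian entries (no symmetry imposed). -/
def gaussianTensor (n q : ℕ) : Measure (Tensor n q) :=
  Measure.pi fun _ => gaussianReal 0 1

/-- The uniform distribution on the unit sphere of `ℝⁿ` (for `1 ≤ n`), as a measure on `ℝⁿ`:
the normalized surface measure. -/
def uniformSphere (n : ℕ) : Measure (EuclideanSpace ℝ (Fin n)) :=
  let σ := (volume : Measure (EuclideanSpace ℝ (Fin n))).toSphere
  ((σ Set.univ)⁻¹ • σ).map Subtype.val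

/-- The observation `Y = (lam / n^(q/2)) u^{⊗ q} + (1 / √n) W`. -/
def observation {n q : ℕ} (lam : ℝ) (u : EuclideanSpace ℝ (Fin n)) (W : Tensor n q) :
    Tensor n q :=
  fun i => lam / (n : ℝ) ^ ((q : ℝ) / 2) * ∏ k, u (i k) + 1 / √(n : ℝ) * W i

/-- The multi-index of length `q` whose first entry is `j` and whose last `q - 1` entries
are those of `i`. -/
def consIndex {n q : ℕ} (j : Fin n) (i : Fin (q - 1) → Fin n) : Fin q → Fin n :=
  fun k => if h : k.val = 0 then j else i ⟨k.val - 1, by omega⟩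

/-- The contraction `Y[x^{⊗ (q-1)}]` of the last `q - 1` slots of `Y` with `x`. -/
def contract {n q : ℕ} (Y : Tensor n q) (x : EuclideanSpace ℝ (Fin n)) :
    EuclideanSpace ℝ (Fin n) :=
  WithLp.toLp 2 fun j => ∑ i : Fin (q - 1) → Fin n, Y (consIndex j i) * ∏ k, x (i k)

/-- Tensor power iteration: `x_k = √n • Y[x_{k-1}^{⊗ (q-1)}] / ‖Y[x_{k-1}^{⊗ (q-1)}]‖₂`. -/
def powerIteration {n q : ℕ} (Y : Tensor n q) (x₀ : EuclideanSpace ℝ (Fin n)) :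
    ℕ → EuclideanSpace ℝ (Fin n)
  | 0 => x₀
  | k + 1 =>
    (√(n : ℝ) / ‖contract Y (powerIteration Y x₀ k)‖) • contract Y (powerIteration Y x₀ k)

/-- The normalized overlap `⟨x, u⟩ / n`. -/
def overlap {n : ℕ} (x u : EuclideanSpace ℝ (Fin n)) : ℝ := inner ℝ x u / n

/-- The exponent `ε_p`, for tensors of order `q ≥ 2`. -/
def epsilon (q p : ℕ) : ℝ :=
  if q = 2 then 1 / (p : ℝ) else ((q : ℝ) - 2) / (((q : ℝ) - 1) ^ p - 1)

end SpikedTensor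

end

/-! Write ρ_k for the cosine of the angle between the k-th iterate and u. Up to a positive factor,
one step sends x to α u + w, where α = λ ρ_k^(q-1) and w is the image under W of the normalized
tensor power of x. If w behaved like a fresh Gaussian vector, then ‖w‖² ≈ n and ⟨u, w⟩ = b √n with b
= O(1), so that ρ_{k+1} is (α + b/√n) / √((α + b/√n)² + κ - b²/n) with κ = ‖w‖²/n ≈ 1
(`IsCosineStep`).

Initially √n ρ_0 = ⟨x₀, u⟩ is asymptotically G. Put s_k = 1 + (q-1) + ⋯ + (q-1)^(k-1) (`geomSum`).
By induction, n^((1 - ε s_k)/2) ρ_k is asymptotically Λ^(s_k) G^((q-1)^k): as long as ε s_k < 1 the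
denominator tends to 1, and b/√n is of lower order than the scale of the numerator. Both formulas
for ε_p say that ε s_p = 1 (`epsilon_eq`), so the numerator first reaches order one at step p, where
t / √(1 + t²) = sin (arctan t) gives the limit (`tendsto_cosine`).

The difficulty is that one W is used at all steps. The tensor powers of the iterates are
orthonormalized by Gram–Schmidt into directions d_0, d_1, …. Direction d_k is a function of the
start and of the responses W d_i with i < k (`dir_congr`), and given these W acts on the orthogonal
complement as an independent Gaussian tensor (`exists_decoupling`). Second moments and Chebyshev
then show that W is nearly √n times an isometry on the first p directions, with images nearly
orthogonal to u (`exists_measure_not_nearIsometry_le`). On that event the recursion above is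
deterministic with controlled errors, and compactness makes its limit uniform
(`exists_forall_cosine_close`). A version of Slutsky's theorem concludes. -/

namespace SpikedTensor

noncomputable section

/-! ### Gaussian vectors: linear functionals, second moments, concentration of the norm. -/

section Gaussian

variable {E : Type*} [NormedAddCommGroup E] [InnerProductSpace ℝ E] [FiniteDimensional ℝ E]
  [MeasurableSpace E] [BorelSpace E]

lemma stdGaussian_map_inner (y : E) :
    (stdGaussian E).map (fun g => inner ℝ y g) = gaussianReal 0 (‖y‖₊ ^ 2) := by
  have hm : Measurable (fun g : E => inner ℝ y g) := by fun_prop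
  have : IsProbabilityMeasure ((stdGaussian E).map (fun g => inner ℝ y g)) :=
    Measure.isProbabilityMeasure_map hm.aemeasurable
  apply Measure.ext_of_charFun
  ext t
  have h := charFun_stdGaussian (t • y)
  rw [charFun_apply] at h
  rw [charFun_apply, integral_map hm.aemeasurable (by fun_prop), charFun_gaussianReal]
  calc _ = ∫ x, Complex.exp (↑(inner ℝ x (t • y)) * Complex.I) ∂(stdGaussian E) := by
        refine integral_congr_ae (.of_forall fun x => ?_)
        simp only [inner_smul_right, real_inner_comm, RCLike.inner_apply, conj_trivial]
    _ = _ := by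
        rw [h, norm_smul]
        congr 1
        push_cast
        rw [mul_pow, ← Complex.ofReal_pow ‖t‖, Real.norm_eq_abs, sq_abs]
        push_cast
        ring

lemma lintegral_sq_gaussianReal (v : NNReal) :
    ∫⁻ x, ENNReal.ofReal (x ^ 2) ∂(gaussianReal 0 v) = v := by
  have h1 : MemLp id 2 (gaussianReal 0 v) := memLp_id_gaussianReal 2
  have h2 : Integrable (fun x : ℝ => x ^ 2) (gaussianReal 0 v) := h1.integrable_sq
  have h3 : Var[fun x => x; gaussianReal 0 v] = v := variance_fun_id_gaussianReal
  rw [variance_eq_integral (by fun_prop)] at h3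
  simp only [integral_id_gaussianReal, sub_zero] at h3
  rw [← ofReal_integral_eq_lintegral_ofReal h2 (.of_forall fun x => sq_nonneg x), h3]
  simp

lemma lintegral_inner_sq_stdGaussian (y : E) :
    ∫⁻ g, ENNReal.ofReal (inner ℝ y g ^ 2) ∂(stdGaussian E) = ENNReal.ofReal (‖y‖ ^ 2) := by
  have h : ∫⁻ x, ENNReal.ofReal (x ^ 2) ∂((stdGaussian E).map (fun g => inner ℝ y g)) =
      ENNReal.ofReal (‖y‖ ^ 2) := by
    rw [stdGaussian_map_inner, lintegral_sq_gaussianReal,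
      ENNReal.ofReal_eq_coe_nnreal (by positivity)]
    congr 1
  rwa [lintegral_map (by fun_prop) (by fun_prop)] at h

end Gaussian

lemma measure_lt_abs_le {α : Type*} [MeasurableSpace α] (μ : Measure α) {f : α → ℝ}
    (hf : AEMeasurable f μ) {c : ℝ} (hc : 0 < c) {B : ℝ}
    (hB : ∫⁻ x, ENNReal.ofReal (f x ^ 2) ∂μ ≤ ENNReal.ofReal B) :
    μ {x | c < |f x|} ≤ ENNReal.ofReal (B / c ^ 2) := by
  have h := meas_ge_le_lintegral_div (μ := μ) (f := fun x => ENNReal.ofReal (f x ^ 2))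
    (by fun_prop) (ε := ENNReal.ofReal (c ^ 2)) (by positivity) ENNReal.ofReal_ne_top
  calc μ {x | c < |f x|} ≤ μ {x | ENNReal.ofReal (c ^ 2) ≤ ENNReal.ofReal (f x ^ 2)} := by
        refine measure_mono fun x hx => ?_
        apply ENNReal.ofReal_le_ofReal
        rw [← sq_abs (f x)]
        have : c < |f x| := hx
        gcongr
    _ ≤ _ := h
    _ ≤ ENNReal.ofReal B / ENNReal.ofReal (c ^ 2) := by gcongr
    _ = _ := by rw [ENNReal.ofReal_div_of_pos (by positivity)]

/-- Chebyshev: ‖g‖² is a sum of n i.i.d. squares of mean 1, so its variance is n times that of one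
square. That variance serves as the constant. -/
lemma exists_measure_norm_sq_stdGaussian_le : ∃ C : ℝ, 0 ≤ C ∧ ∀ (n : ℕ) (δ : ℝ), 1 ≤ n → 0 < δ →
    stdGaussian (EuclideanSpace ℝ (Fin n)) {g | δ * n < |‖g‖ ^ 2 - n|} ≤
      ENNReal.ofReal (C / (δ ^ 2 * n)) := by
  have h4 : MemLp (fun x : ℝ => x ^ 2) 2 (gaussianReal 0 1) := by
    have h := memLp_id_gaussianReal (μ := 0) (v := 1) 4
    rw [show (fun x : ℝ => x ^ 2) = fun x => ‖id x‖ ^ (2 : ℝ) by ext; simp]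
    have := h.norm_rpow_div 2
    convert this using 2
    · simp
    · rw [show ((4 : NNReal) : ENNReal) = 2 * 2 by norm_num]
      rw [ENNReal.mul_div_cancel_right (by simp) (by simp)]
  refine ⟨Var[fun x => x ^ 2; gaussianReal 0 1], variance_nonneg _ _, fun n δ hn hδ => ?_⟩
  set V := Var[fun x => x ^ 2; gaussianReal 0 1]
  let X : Fin n → ℝ → ℝ := fun _ x => x ^ 2
  have hS : MemLp (∑ i, fun w : Fin n → ℝ => X i (w i)) 2
      (Measure.pi fun _ => gaussianReal 0 1) := by
    apply memLp_finsetSum'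
    intro i _
    exact h4.comp_measurePreserving (measurePreserving_eval _ i)
  have hvar := variance_sum_pi (μ := fun _ : Fin n => gaussianReal 0 1) (X := X) (fun _ => h4)
  have hm : ∫ w, (∑ i, fun w : Fin n → ℝ => X i (w i)) w
      ∂(Measure.pi fun _ => gaussianReal 0 1) = n := by
    simp only [Finset.sum_apply]
    rw [integral_finsetSum]
    · have : ∀ i : Fin n, ∫ w : Fin n → ℝ, X i (w i) ∂(Measure.pi fun _ => gaussianReal 0 1) = 1 := by
        intro i
        rw [integral_comp_eval (μ := fun _ : Fin n => gaussianReal 0 1) (f := X i) (by fun_prop)]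
        have h3 : Var[fun x => x; gaussianReal 0 1] = (1 : NNReal) := variance_fun_id_gaussianReal
        rw [variance_eq_integral (by fun_prop)] at h3
        simpa using h3
      simp [this]
    · intro i _
      exact (h4.comp_measurePreserving (measurePreserving_eval _ i)).integrable (by norm_num)
  have hn' : (0 : ℝ) < n := by exact_mod_cast hn
  have hch := meas_ge_le_variance_div_sq hS (c := δ * n) (by positivity)
  rw [hvar, hm] at hch
  rw [← map_pi_eq_stdGaussian, Measure.map_apply (by fun_prop)
    (measurableSet_lt (by fun_prop) (by fun_prop))]
  refine (measure_mono ?_).trans (hch.trans_eq ?_)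
  · intro w hw
    simp only [Set.mem_preimage, Set.mem_ofPred_eq, EuclideanSpace.real_norm_sq_eq] at hw
    simpa [X] using hw.le
  · congr 1
    simp only [X, Finset.sum_const, Finset.card_univ, Fintype.card_fin, nsmul_eq_mul]
    change (n * V) / _ = _
    field_simp

/-! ### The uniform law on the sphere as the direction of a Gaussian vector; the cube. -/

section Sphere

variable {E : Type*} [NormedAddCommGroup E] [InnerProductSpace ℝ E] [FiniteDimensional ℝ E]
  [MeasurableSpace E] [BorelSpace E]

variable (E) in
-- Only radiality of the density matters later. The explicit Gaussian density is identified by its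
-- characteristic function.
lemma exists_stdGaussian_eq_withDensity : ∃ f : ℝ → ENNReal, Measurable f ∧
    stdGaussian E = (volume : Measure E).withDensity (fun x => f ‖x‖) := by
  set c : ℝ := ((Real.pi / (1 / 2)) ^ (Module.finrank ℝ E / 2 : ℝ))⁻¹ with hc
  have hc0 : 0 < c := by positivity
  have hint : ∫ v : E, Real.exp (-(1 / 2) * ‖v‖ ^ 2) = c⁻¹ := by
    rw [GaussianFourier.integral_rexp_neg_mul_sq_norm (by norm_num), hc, inv_inv]
  -- A non-integrable function has Bochner integral 0 by convention, which contradicts the positive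
  -- value just computed.
  have hI : Integrable (fun v : E => Real.exp (-(1 / 2) * ‖v‖ ^ 2)) := by
    by_contra h
    rw [integral_undef h] at hint
    exact (inv_pos.2 hc0).ne hint
  refine ⟨fun r => ENNReal.ofReal (c * Real.exp (-(1 / 2) * r ^ 2)), by fun_prop, ?_⟩
  have hfin : IsFiniteMeasure ((volume : Measure E).withDensity
      (fun x => ENNReal.ofReal (c * Real.exp (-(1 / 2) * ‖x‖ ^ 2)))) :=
    isFiniteMeasure_withDensity_ofReal (hI.const_mul c).2
  apply Measure.ext_of_charFun
  ext t
  rw [charFun_stdGaussian, charFun_apply,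
    integral_withDensity_eq_integral_toReal_smul (by fun_prop) (by simp)]
  have h := GaussianFourier.integral_cexp_neg_mul_sq_norm_add (V := E) (b := (1 / 2 : ℂ))
    (by norm_num) Complex.I t
  have h2 : ∀ x : E, (ENNReal.ofReal (c * Real.exp (-(1 / 2) * ‖x‖ ^ 2))).toReal •
      Complex.exp (↑(inner ℝ x t) * Complex.I) =
      c * Complex.exp (-(1 / 2) * ‖x‖ ^ 2 + Complex.I * (inner ℝ t x : ℝ)) := by
    intro x
    rw [ENNReal.toReal_ofReal (by positivity), Complex.exp_add, real_inner_comm,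
      Complex.real_smul]
    push_cast
    ring_nf
  simp_rw [h2]
  rw [integral_const_mul, h, ← mul_assoc]
  have : (c : ℂ) * (Real.pi / (1 / 2)) ^ (Module.finrank ℝ E / 2 : ℂ) = 1 := by
    rw [hc]
    push_cast
    rw [Complex.ofReal_cpow (by positivity)]
    push_cast
    rw [inv_mul_cancel₀]
    rw [Complex.cpow_ne_zero_iff]
    left
    exact div_ne_zero (by exact_mod_cast Real.pi_ne_zero) (by norm_num)
  rw [this, one_mul, Complex.I_sq]
  congr 1
  ring

/-- In polar coordinates Lebesgue measure is a product, so under a radial density the direction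
follows the surface measure, up to the radial integral C. -/
lemma exists_withDensity_preimage_direction [Nontrivial E] {f : ℝ → ENNReal} (hf : Measurable f) :
    ∃ C : ENNReal, ∀ s : Set E, MeasurableSet s →
    ((volume : Measure E).withDensity (fun x => f ‖x‖)) ((fun z => ‖z‖⁻¹ • z) ⁻¹' s) =
      (volume : Measure E).toSphere (Subtype.val ⁻¹' s) * C := by
  refine ⟨∫⁻ r : Set.Ioi (0 : ℝ), f r ∂(Measure.volumeIoiPow (Module.finrank ℝ E - 1)),
    fun s hs => ?_⟩
  have hm : Measurable (fun z : E => ‖z‖⁻¹ • z) := by fun_prop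
  have hmp := (volume : Measure E).measurePreserving_homeomorphUnitSphereProd
  have hs' : MeasurableSet ((fun z : E => ‖z‖⁻¹ • z) ⁻¹' s) := hm hs
  let F : E → ENNReal := ((fun z : E => ‖z‖⁻¹ • z) ⁻¹' s).indicator (fun x => f ‖x‖)
  have h0 : ({0}ᶜ : Set E) =ᵐ[volume] Set.univ := by
    rw [Filter.eventuallyEq_univ, mem_ae_iff, compl_compl]
    exact measure_singleton 0
  rw [withDensity_apply _ hs', ← lintegral_indicator hs']
  change ∫⁻ x, F x = _
  rw [← setLIntegral_univ, ← setLIntegral_congr h0,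
    ← lintegral_subtype_comap (measurableSet_singleton (0 : E)).compl]
  have h1 : ∀ x : ({0}ᶜ : Set E), F x = (fun p : Metric.sphere (0 : E) 1 × Set.Ioi (0 : ℝ) =>
      ((Subtype.val ⁻¹' s : Set (Metric.sphere (0 : E) 1)).indicator 1 p.1) * f p.2)
        (homeomorphUnitSphereProd E x) := by
    intro x
    by_cases hx : ‖x.1‖⁻¹ • x.1 ∈ s <;> simp [F, hx, Set.indicator]
  simp_rw [h1]
  have hsS : MeasurableSet (Subtype.val ⁻¹' s : Set (Metric.sphere (0 : E) 1)) :=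
    measurable_subtype_coe hs
  rw [hmp.lintegral_comp (f := fun p : Metric.sphere (0 : E) 1 × Set.Ioi (0 : ℝ) =>
      ((Subtype.val ⁻¹' s : Set (Metric.sphere (0 : E) 1)).indicator 1 p.1) * f p.2)]
  · rw [lintegral_prod_mul (f := (Subtype.val ⁻¹' s : Set (Metric.sphere (0 : E) 1)).indicator 1)
      (g := fun r : Set.Ioi (0 : ℝ) => f r), lintegral_indicator_one hsS]
    · exact (measurable_one.indicator hsS).aemeasurable
    · exact (hf.comp measurable_subtype_coe).aemeasurable
  · exact ((measurable_one.indicator hsS).comp measurable_fst).mul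
      (hf.comp (measurable_subtype_coe.comp measurable_snd))

end Sphere

lemma uniformSphere_eq_map_stdGaussian {n : ℕ} (hn : 1 ≤ n) :
    uniformSphere n = (stdGaussian (EuclideanSpace ℝ (Fin n))).map (fun z => ‖z‖⁻¹ • z) := by
  have : Nonempty (Fin n) := ⟨⟨0, hn⟩⟩
  have hnt : Nontrivial (EuclideanSpace ℝ (Fin n)) := inferInstance
  obtain ⟨f, hf, hd⟩ := exists_stdGaussian_eq_withDensity (EuclideanSpace ℝ (Fin n))
  obtain ⟨C, hC⟩ := exists_withDensity_preimage_direction (E := EuclideanSpace ℝ (Fin n)) hf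
  have hm : Measurable (fun z : EuclideanSpace ℝ (Fin n) => ‖z‖⁻¹ • z) := by fun_prop
  have hu := hC Set.univ MeasurableSet.univ
  rw [← hd, Set.preimage_univ, Set.preimage_univ, measure_univ] at hu
  set σ := (volume : Measure (EuclideanSpace ℝ (Fin n))).toSphere
  have hσ : σ Set.univ ≠ 0 := by
    intro h; rw [h, zero_mul] at hu; exact one_ne_zero hu
  -- Total mass one forces the radial integral to be the normalizing constant of the surface
  -- measure.
  have hCe : C = (σ Set.univ)⁻¹ := by
    rw [mul_comm] at hu
    exact ENNReal.eq_inv_of_mul_eq_one_left hu.symm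
  ext s hs
  rw [Measure.map_apply hm hs, hd, hC s hs, hCe, uniformSphere,
    Measure.map_apply measurable_subtype_coe hs, Measure.smul_apply, smul_eq_mul, mul_comm]

lemma isProbabilityMeasure_uniformSphere {n : ℕ} (hn : 1 ≤ n) :
    IsProbabilityMeasure (uniformSphere n) := by
  rw [uniformSphere_eq_map_stdGaussian hn]
  exact Measure.isProbabilityMeasure_map (by fun_prop)

lemma ae_norm_uniformSphere (n : ℕ) : ∀ᵐ x ∂(uniformSphere n), ‖x‖ = 1 := by
  rw [uniformSphere, ae_map_iff (by fun_prop) (measurableSet_eq_fun (by fun_prop) (by fun_prop))]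
  exact .of_forall fun x => by simp

instance (n : ℕ) : IsProbabilityMeasure (uniformCube n) := by
  have hfin : {u : EuclideanSpace ℝ (Fin n) | ∀ i, u i = 1 ∨ u i = -1}.Finite := by
    have h : (Set.pi Set.univ fun _ : Fin n => ({1, -1} : Set ℝ)).Finite :=
      Set.Finite.pi fun _ => Set.toFinite _
    refine (h.preimage (f := WithLp.ofLp) (WithLp.ofLp_injective 2).injOn).subset ?_
    intro u hu i _
    simpa using hu i
  exact isProbabilityMeasure_uniformOn hfin ⟨WithLp.toLp 2 fun _ => 1, fun i => Or.inl rfl⟩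

lemma ae_uniformCube (n : ℕ) : ∀ᵐ u ∂(uniformCube n), ‖u‖ ^ 2 = n := by
  have hms : MeasurableSet {u : EuclideanSpace ℝ (Fin n) | ∀ i, u i = 1 ∨ u i = -1} := by
    simp only [Set.ofPred_forall, Set.ofPred_or]
    refine MeasurableSet.iInter fun i => ?_
    exact (measurableSet_eq_fun (by fun_prop) (by fun_prop)).union
      (measurableSet_eq_fun (by fun_prop) (by fun_prop))
  have h : ∀ᵐ u ∂(uniformCube n), u ∈ {u : EuclideanSpace ℝ (Fin n) | ∀ i, u i = 1 ∨ u i = -1} :=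
    ae_cond_mem hms
  filter_upwards [h] with u hu
  rw [EuclideanSpace.real_norm_sq_eq]
  have : ∀ i, u i ^ 2 = 1 := fun i => by rcases hu i with h | h <;> simp [h]
  simp [this]

/-! ### Tensors as n × n^(q-1) matrices, and Gaussian resampling along one direction. -/

section

variable {n q : ℕ}

/-- Vectors indexed by the last `q - 1` slots of a tensor of order `q`. -/
abbrev SlotSpace (n q : ℕ) : Type := EuclideanSpace ℝ (Fin (q - 1) → Fin n)

/-- The action of a tensor of order `q`, seen as an `n × n ^ (q - 1)` matrix. -/
def act : Tensor n q →ₗ[ℝ] SlotSpace n q →ₗ[ℝ] EuclideanSpace ℝ (Fin n) :=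
  LinearMap.mk₂ ℝ (fun W v => WithLp.toLp 2 fun j => ∑ i, W (consIndex j i) * v i)
    (fun W W' v => by ext j; simp [add_mul, Finset.sum_add_distrib])
    (fun c W v => by ext j; simp [Finset.mul_sum, mul_assoc])
    (fun W v v' => by ext j; simp [mul_add, Finset.sum_add_distrib])
    (fun c W v => by ext j; simp [Finset.mul_sum, mul_left_comm])

lemma act_apply (W : Tensor n q) (v : SlotSpace n q) (j : Fin n) :
    act W v j = ∑ i, W (consIndex j i) * v i := rfl

/-- The tensor power `x^{⊗ (q-1)}`. -/
def tensorPower (q : ℕ) (x : EuclideanSpace ℝ (Fin n)) : SlotSpace n q :=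
  WithLp.toLp 2 fun i => ∏ k, x (i k)

lemma contract_eq_act (Y : Tensor n q) (x : EuclideanSpace ℝ (Fin n)) :
    contract Y x = act Y (tensorPower q x) := rfl

lemma norm_tensorPower (x : EuclideanSpace ℝ (Fin n)) :
    ‖tensorPower q x‖ = ‖x‖ ^ (q - 1) := by
  have h : ‖tensorPower q x‖ ^ 2 = (‖x‖ ^ (q - 1)) ^ 2 := by
    rw [← pow_mul, mul_comm, pow_mul, EuclideanSpace.real_norm_sq_eq,
      EuclideanSpace.real_norm_sq_eq]
    have := Finset.sum_pow' (Finset.univ : Finset (Fin n)) (fun j => x j ^ 2) (q - 1)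
    rw [this, Fintype.piFinset_univ]
    simp [tensorPower, Finset.prod_pow]
  exact (pow_left_inj₀ (norm_nonneg _) (by positivity) two_ne_zero).1 h

/-- Splitting off the first slot of a multi-index. -/
def consEquiv (n : ℕ) (hq : 1 ≤ q) : Fin n × (Fin (q - 1) → Fin n) ≃ (Fin q → Fin n) where
  toFun p := consIndex p.1 p.2
  invFun i := (i ⟨0, hq⟩, fun k => i ⟨k + 1, by omega⟩)
  left_inv p := by
    ext k <;> simp [consIndex]
  right_inv i := by
    ext k
    simp only [consIndex]
    split_ifs with h
    · congr 2
      ext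
      exact h.symm
    · congr 2
      ext
      simp
      omega

/-- The rank-one tensor `d ⊗ e`. -/
def outer (hq : 1 ≤ q) (d : EuclideanSpace ℝ (Fin n)) (e : SlotSpace n q) : Tensor n q :=
  fun i => d ((consEquiv n hq).symm i).1 * e ((consEquiv n hq).symm i).2

lemma outer_consIndex (hq : 1 ≤ q) (d : EuclideanSpace ℝ (Fin n)) (e : SlotSpace n q)
    (j : Fin n) (i : Fin (q - 1) → Fin n) : outer hq d e (consIndex j i) = d j * e i := by
  have : (consEquiv n hq).symm (consIndex j i) = (j, i) :=
    (consEquiv n hq).symm_apply_apply (j, i)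
  simp [outer, this]

lemma act_outer (hq : 1 ≤ q) (d : EuclideanSpace ℝ (Fin n)) (e v : SlotSpace n q) :
    act (outer hq d e) v = inner ℝ e v • d := by
  ext j
  simp only [act_apply, outer_consIndex, PiLp.inner_apply, RCLike.inner_apply, conj_trivial,
    PiLp.smul_apply, smul_eq_mul, Finset.sum_mul]
  exact Finset.sum_congr rfl fun i _ => by ring

lemma inner_outer (hq : 1 ≤ q) (d : EuclideanSpace ℝ (Fin n)) (e : SlotSpace n q)
    (t : EuclideanSpace ℝ (Fin q → Fin n)) :
    inner ℝ (WithLp.toLp 2 (outer hq d e)) t = inner ℝ d (act t.ofLp e) := by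
  simp only [PiLp.inner_apply, RCLike.inner_apply, conj_trivial]
  rw [← (consEquiv n hq).sum_comp, Fintype.sum_prod_type]
  refine Finset.sum_congr rfl fun j _ => ?_
  rw [act_apply, Finset.sum_mul]
  refine Finset.sum_congr rfl fun i _ => ?_
  change _ * outer hq d e (consIndex j i) = _
  rw [outer_consIndex]
  change t (consIndex j i) * _ = _
  ring

lemma contract_observation (hq : 1 ≤ q) (lam : ℝ) (u x : EuclideanSpace ℝ (Fin n))
    (W : Tensor n q) :
    contract (observation lam u W) x =
      (lam / (n : ℝ) ^ ((q : ℝ) / 2) * inner ℝ u x ^ (q - 1)) • u +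
        (1 / √(n : ℝ)) • act W (tensorPower q x) := by
  have h1 : observation lam u W =
      (lam / (n : ℝ) ^ ((q : ℝ) / 2)) • outer hq u (tensorPower q u) + (1 / √(n : ℝ)) • W := by
    ext i
    obtain ⟨⟨j, i⟩, rfl⟩ := (consEquiv n hq).surjective i
    change observation lam u W (consIndex j i) = _ * outer hq u _ (consIndex j i) + _
    rw [outer_consIndex, observation]
    congr 2
    obtain ⟨m, rfl⟩ : ∃ m, q = m + 1 := ⟨q - 1, by omega⟩
    rw [Fin.prod_univ_succ]
    simp [consIndex, tensorPower]
  have h2 : inner ℝ (tensorPower q u) (tensorPower q x) = inner ℝ u x ^ (q - 1) := by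
    simp only [PiLp.inner_apply, RCLike.inner_apply, conj_trivial]
    have := Finset.sum_pow' (Finset.univ : Finset (Fin n)) (fun j => x j * u j) (q - 1)
    rw [this, Fintype.piFinset_univ]
    simp [tensorPower, Finset.prod_mul_distrib]
  rw [contract_eq_act, h1]
  simp only [map_add, map_smul, LinearMap.add_apply, LinearMap.smul_apply, act_outer, h2, smul_smul]

/-- Replace the action of `W` on `e` by `g`. -/
def resample (hq : 1 ≤ q) (e : SlotSpace n q) (g : EuclideanSpace ℝ (Fin n)) (W : Tensor n q) :
    Tensor n q :=
  W + outer hq (g - act W e) e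

lemma act_resample (hq : 1 ≤ q) (e v : SlotSpace n q) (g : EuclideanSpace ℝ (Fin n))
    (W : Tensor n q) :
    act (resample hq e g W) v = act W v + inner ℝ e v • (g - act W e) := by
  rw [resample, map_add, LinearMap.add_apply, act_outer]

lemma resample_zero (hq : 1 ≤ q) (g : EuclideanSpace ℝ (Fin n)) (W : Tensor n q) :
    resample hq 0 g W = W := by
  ext i
  simp [resample, outer]

instance (n q : ℕ) : IsProbabilityMeasure (gaussianTensor n q) := by
  unfold gaussianTensor; infer_instance

lemma measurable_act : Measurable fun p : Tensor n q × SlotSpace n q => act p.1 p.2 := by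
  refine (WithLp.measurable_toLp 2 _).comp ?_
  refine measurable_pi_lambda _ fun j => ?_
  fun_prop

lemma measurable_outer (hq : 1 ≤ q) :
    Measurable fun p : EuclideanSpace ℝ (Fin n) × SlotSpace n q => outer hq p.1 p.2 := by
  refine measurable_pi_lambda _ fun i => ?_
  unfold outer
  fun_prop

lemma measurable_resample (hq : 1 ≤ q) : Measurable
    fun p : SlotSpace n q × EuclideanSpace ℝ (Fin n) × Tensor n q =>
      resample hq p.1 p.2.1 p.2.2 := by
  have h1 : Measurable fun p : SlotSpace n q × EuclideanSpace ℝ (Fin n) × Tensor n q =>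
      act p.2.2 p.1 := measurable_act.comp (measurable_snd.snd.prodMk measurable_fst)
  exact measurable_snd.snd.add
    ((measurable_outer hq).comp ((measurable_snd.fst.sub h1).prodMk measurable_fst))

/-- The part of W along e and the part orthogonal to it are independent, so the first may be
replaced by a fresh copy. On characteristic functions: a frequency t splits orthogonally as d ⊗ e +
t', the first piece testing g and the second testing W. The value e = 0 is allowed because
Gram–Schmidt produces it on degenerate input. -/
lemma map_resample (hq : 1 ≤ q) {e : SlotSpace n q} (he : ‖e‖ = 0 ∨ ‖e‖ = 1) :
    ((stdGaussian (EuclideanSpace ℝ (Fin n))).prod (gaussianTensor n q)).map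
      (fun p => resample hq e p.1 p.2) = gaussianTensor n q := by
  rcases he with he | he
  · rw [norm_eq_zero] at he
    subst he
    simp only [resample_zero]
    exact measurePreserving_snd.map_eq
  have hm : Measurable fun p : EuclideanSpace ℝ (Fin n) × Tensor n q => resample hq e p.1 p.2 :=
    (measurable_resample hq).comp (measurable_const.prodMk measurable_id)
  have : IsProbabilityMeasure (((stdGaussian (EuclideanSpace ℝ (Fin n))).prod
      (gaussianTensor n q)).map (fun p => resample hq e p.1 p.2)) :=
    Measure.isProbabilityMeasure_map hm.aemeasurable
  rw [gaussianTensor] at this ⊢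
  refine charFun_eq_pi_iff.1 fun t => ?_
  set d := act t.ofLp e
  set t' : EuclideanSpace ℝ (Fin q → Fin n) := t - WithLp.toLp 2 (outer hq d e) with ht'
  have hadj : ∀ (d' : EuclideanSpace ℝ (Fin n)) (W : Tensor n q),
      inner ℝ (WithLp.toLp 2 (outer hq d' e)) (WithLp.toLp 2 W) = inner ℝ d' (act W e) :=
    fun d' W => inner_outer hq d' e (WithLp.toLp 2 W)
  have hinner : ∀ (g : EuclideanSpace ℝ (Fin n)) (W : Tensor n q),
      inner ℝ (WithLp.toLp 2 (resample hq e g W)) t =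
        inner ℝ g d + inner ℝ (WithLp.toLp 2 W : EuclideanSpace ℝ (Fin q → Fin n)) t' := by
    intro g W
    rw [resample, WithLp.toLp_add, inner_add_left, inner_outer, ht', inner_sub_right,
      inner_sub_left, real_inner_comm (WithLp.toLp 2 (outer hq d e)), hadj,
      real_inner_comm d (act W e)]
    ring
  have hnorm : ‖t'‖ ^ 2 = ‖t‖ ^ 2 - ‖d‖ ^ 2 := by
    have h1 : inner ℝ t (WithLp.toLp 2 (outer hq d e)) = ‖d‖ ^ 2 := by
      rw [real_inner_comm, inner_outer, real_inner_self_eq_norm_sq]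
    have h2 : ‖(WithLp.toLp 2 (outer hq d e) : EuclideanSpace ℝ (Fin q → Fin n))‖ ^ 2 =
        ‖d‖ ^ 2 := by
      rw [← real_inner_self_eq_norm_sq, hadj, act_outer, real_inner_self_eq_norm_sq, he]
      simp
    rw [ht', norm_sub_sq_real, h1, h2]
    ring
  have hg := charFun_stdGaussian d
  have hW := charFun_stdGaussian t'
  rw [← map_pi_eq_stdGaussian] at hW
  rw [charFun_apply] at hg hW
  rw [integral_map (by fun_prop) (by fun_prop)] at hW
  have hprod : ∏ i, charFun (gaussianReal 0 1) (t i) = Complex.exp (-‖t‖ ^ 2 / 2) := by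
    rw [← charFun_stdGaussian t, ← map_pi_eq_stdGaussian, charFun_pi]
  rw [hprod, charFun_apply, integral_map (by fun_prop) (by fun_prop),
    integral_map hm.aemeasurable (by fun_prop)]
  simp only [hinner, Complex.ofReal_add, add_mul, Complex.exp_add]
  rw [integral_prod_mul (fun g => Complex.exp (↑(inner ℝ g d) * Complex.I))
    (fun W => Complex.exp (↑(inner ℝ (WithLp.toLp 2 W) t') * Complex.I)), hg, hW,
    ← Complex.exp_add]
  congr 1
  rw [← Complex.ofReal_pow ‖t'‖, hnorm]
  push_cast
  ring

/-- After resampling along a unit vector e, the image of e is exactly the fresh vector g. -/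
lemma map_act {e : SlotSpace n q} (hq : 1 ≤ q) (he : ‖e‖ = 1) :
    (gaussianTensor n q).map (fun W => act W e) = stdGaussian (EuclideanSpace ℝ (Fin n)) := by
  have h1 : Measurable fun W : Tensor n q => act W e :=
    measurable_act.comp (measurable_id.prodMk measurable_const)
  have h2 : Measurable fun p : EuclideanSpace ℝ (Fin n) × Tensor n q => resample hq e p.1 p.2 :=
    (measurable_resample hq).comp (measurable_const.prodMk measurable_id)
  rw [← map_resample hq (Or.inr he), Measure.map_map h1 h2]
  have : (fun W => act W e) ∘ (fun p : EuclideanSpace ℝ (Fin n) × Tensor n q =>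
      resample hq e p.1 p.2) = Prod.fst := by
    ext p
    simp [act_resample, he]
  rw [this]
  exact measurePreserving_fst.map_eq

end

/-! ### Gram–Schmidt directions of the iterates and their dependence on the noise. -/

section

section GramSchmidt

open InnerProductSpace

variable {V : Type*} [NormedAddCommGroup V] [InnerProductSpace ℝ V]

lemma gramSchmidt_congr {f g : ℕ → V} {k : ℕ} (h : ∀ i ≤ k, f i = g i) :
    ∀ i ≤ k, gramSchmidt ℝ f i = gramSchmidt ℝ g i := by
  intro i
  induction i using Nat.strong_induction_on with
  | _ i ih =>
    intro hi
    rw [gramSchmidt_def, gramSchmidt_def, h i hi]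
    congr 1
    refine Finset.sum_congr rfl fun j hj => ?_
    rw [Finset.mem_Iio] at hj
    rw [ih j hj (hj.le.trans hi)]

/-- No linear independence is needed: a vector depending on the earlier ones yields the zero
direction, and its term vanishes. -/
lemma sum_inner_gramSchmidtNormed_smul (f : ℕ → V) (k : ℕ) :
    ∑ i ∈ Finset.range (k + 1),
      inner ℝ (gramSchmidtNormed ℝ f i) (f k) • gramSchmidtNormed ℝ f i = f k := by
  have hterm : ∀ i, inner ℝ (gramSchmidtNormed ℝ f i) (f k) • gramSchmidtNormed ℝ f i =
      (inner ℝ (gramSchmidt ℝ f i) (f k) / ‖gramSchmidt ℝ f i‖ ^ 2) • gramSchmidt ℝ f i := by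
    intro i
    simp only [gramSchmidtNormed, RCLike.ofReal_real_eq_id, id, real_inner_smul_left, smul_smul]
    congr 1
    rw [div_eq_mul_inv, ← inv_pow]
    ring
  have hdef := gramSchmidt_def'' ℝ f k
  have hIio : Finset.Iio k = Finset.range k := by ext; simp
  have hself : inner ℝ (gramSchmidt ℝ f k) (f k) = ‖gramSchmidt ℝ f k‖ ^ 2 := by
    conv_lhs => rw [hdef]
    rw [inner_add_right, inner_sum, Finset.sum_eq_zero, add_zero, real_inner_self_eq_norm_sq]
    intro i hi
    rw [inner_smul_right, gramSchmidt_orthogonal ℝ f (Finset.mem_Iio.1 hi).ne', mul_zero]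
  simp_rw [hterm]
  rw [Finset.sum_range_succ, hself]
  conv_rhs => rw [hdef, hIio, add_comm]
  congr 1
  by_cases h0 : gramSchmidt ℝ f k = 0
  · simp [h0]
  · rw [div_self (by simpa using h0), one_smul]

lemma norm_gramSchmidtNormed_eq (f : ℕ → V) (i : ℕ) :
    ‖gramSchmidtNormed ℝ f i‖ = 0 ∨ ‖gramSchmidtNormed ℝ f i‖ = 1 := by
  by_cases h : gramSchmidtNormed ℝ f i = 0
  · left; simp [h]
  · right; exact gramSchmidtNormed_unit_length' h

lemma inner_gramSchmidtNormed_of_ne (f : ℕ → V) {i j : ℕ} (h : i ≠ j) :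
    inner ℝ (gramSchmidtNormed ℝ f i) (gramSchmidtNormed ℝ f j) = 0 := by
  simp [gramSchmidtNormed, inner_smul_left, inner_smul_right, gramSchmidt_orthogonal ℝ f h]

lemma measurable_gramSchmidtNormed [MeasurableSpace V] [BorelSpace V] [SecondCountableTopology V]
    {α : Type*} [MeasurableSpace α] {f : α → ℕ → V} (hf : ∀ k, Measurable fun a => f a k) (k : ℕ) :
    Measurable fun a => gramSchmidtNormed ℝ (f a) k := by
  have h : ∀ k, Measurable fun a => gramSchmidt ℝ (f a) k := by
    intro k
    induction k using Nat.strong_induction_on with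
    | _ k ih =>
      have : (fun a => gramSchmidt ℝ (f a) k) = fun a => f a k - ∑ i ∈ Finset.Iio k,
          (inner ℝ (gramSchmidt ℝ (f a) i) (f a k) / ‖gramSchmidt ℝ (f a) i‖ ^ 2) •
            gramSchmidt ℝ (f a) i := by
        ext a
        rw [eq_sub_iff_add_eq]
        exact (gramSchmidt_def'' ℝ (f a) k).symm
      rw [this]
      refine (hf k).sub (Finset.measurable_sum _ fun i hi => ?_)
      have hi' := ih i (Finset.mem_Iio.1 hi)
      exact ((hi'.inner (hf k)).div (hi'.norm.pow_const 2)).smul hi'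
  simp only [gramSchmidtNormed, RCLike.ofReal_real_eq_id, id]
  exact (h k).norm.inv.smul (h k)

end GramSchmidt

variable {n q : ℕ}

/-- The pair consisting of the signal and of the initialization. -/
abbrev Start (n : ℕ) : Type := EuclideanSpace ℝ (Fin n) × EuclideanSpace ℝ (Fin n)

/-- The iterates of power iteration as functions of the signal, initialization and noise. -/
def traj (lam : ℝ) (s : Start n) (W : Tensor n q) (k : ℕ) : EuclideanSpace ℝ (Fin n) :=
  powerIteration (observation lam s.1 W) s.2 k

/-- The vector on which the noise acts at step `k` of power iteration. -/
def query (lam : ℝ) (s : Start n) (W : Tensor n q) (k : ℕ) : SlotSpace n q :=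
  tensorPower q (traj lam s W k)

/-- The orthonormalization of the vectors on which the noise acts. -/
def dir (lam : ℝ) (s : Start n) (W : Tensor n q) (k : ℕ) : SlotSpace n q :=
  InnerProductSpace.gramSchmidtNormed ℝ (query lam s W) k

lemma traj_succ (hq : 1 ≤ q) (lam : ℝ) (s : Start n) (W : Tensor n q) (k : ℕ) :
    ∃ z, z = (lam / (n : ℝ) ^ ((q : ℝ) / 2) * inner ℝ s.1 (traj lam s W k) ^ (q - 1)) • s.1 +
        (1 / √(n : ℝ)) • act W (query lam s W k) ∧
      traj lam s W (k + 1) = (√(n : ℝ) / ‖z‖) • z :=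
  ⟨_, rfl, by rw [query, ← contract_observation hq]; rfl⟩

lemma traj_congr (hq : 1 ≤ q) (lam : ℝ) (s : Start n) {W W' : Tensor n q} {k : ℕ}
    (h : ∀ i < k, act W (query lam s W i) = act W' (query lam s W i)) :
    ∀ i ≤ k, traj lam s W i = traj lam s W' i := by
  intro i
  induction i with
  | zero => intro _; rfl
  | succ i ih =>
    intro hi
    have hi' := ih (by omega)
    obtain ⟨z, hz, ht⟩ := traj_succ hq lam s W i
    obtain ⟨z', hz', ht'⟩ := traj_succ hq lam s W' i
    have : z = z' := by
      rw [hz, hz', h i hi, hi', query, query, hi']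
    rw [ht, ht', this]

lemma query_eq_sum (lam : ℝ) (s : Start n) (W : Tensor n q) (k : ℕ) :
    query lam s W k =
      ∑ i ∈ Finset.range (k + 1), inner ℝ (dir lam s W i) (query lam s W k) • dir lam s W i :=
  (sum_inner_gramSchmidtNormed_smul _ k).symm

/-- Adaptedness: each query is a combination of the directions up to its own index, so the responses
on earlier directions determine the earlier responses to queries, hence the iterates up to k and the
direction d_k. -/
lemma dir_congr (hq : 1 ≤ q) (lam : ℝ) (s : Start n) {W W' : Tensor n q} {k : ℕ}
    (h : ∀ i < k, act W (dir lam s W i) = act W' (dir lam s W i)) :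
    ∀ i ≤ k, dir lam s W i = dir lam s W' i := by
  have h1 : ∀ i < k, act W (query lam s W i) = act W' (query lam s W i) := by
    intro i hi
    rw [query_eq_sum, map_sum, map_sum]
    refine Finset.sum_congr rfl fun j hj => ?_
    rw [map_smul, map_smul, h j (by rw [Finset.mem_range] at hj; omega)]
  have h2 := traj_congr hq lam s h1
  intro i hi
  have h3 := gramSchmidt_congr (V := SlotSpace n q) (f := query lam s W) (g := query lam s W')
    (k := k) (fun j hj => by rw [query, query, h2 j hj]) i hi
  simp only [dir, InnerProductSpace.gramSchmidtNormed, h3]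

lemma measurable_observation (lam : ℝ) :
    Measurable fun p : EuclideanSpace ℝ (Fin n) × Tensor n q => observation lam p.1 p.2 := by
  refine measurable_pi_lambda _ fun i => ?_
  unfold observation
  fun_prop

lemma measurable_tensorPower : Measurable (tensorPower q (n := n)) := by
  refine (WithLp.measurable_toLp 2 _).comp (measurable_pi_lambda _ fun i => ?_)
  fun_prop

lemma measurable_traj (lam : ℝ) (k : ℕ) :
    Measurable fun p : Start n × Tensor n q => traj lam p.1 p.2 k := by
  induction k with
  | zero => exact measurable_fst.snd
  | succ k ih =>
    have h : Measurable fun p : Start n × Tensor n q =>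
        contract (observation lam p.1.1 p.2) (traj lam p.1 p.2 k) :=
      measurable_act.comp (((measurable_observation lam).comp
        (measurable_fst.fst.prodMk measurable_snd)).prodMk (measurable_tensorPower.comp ih))
    exact (measurable_const.div h.norm).smul h

lemma measurable_dir (lam : ℝ) (k : ℕ) :
    Measurable fun p : Start n × Tensor n q => dir lam p.1 p.2 k :=
  measurable_gramSchmidtNormed (fun k => measurable_tensorPower.comp (measurable_traj lam k)) k

end

/-! ### Decoupling the noise from the past; the near-isometry event. -/

section

variable {n q : ℕ}

/-- The noise can be represented so that its action on the first `k` directions is frozen, while it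
acts on the orthogonal complement of these directions as an independent Gaussian tensor. -/
lemma exists_decoupling (hq : 1 ≤ q) (lam : ℝ) (μ : Measure (Start n)) [IsProbabilityMeasure μ]
    (k : ℕ) :
    ∃ (X : Type) (_ : MeasurableSpace X) (ν : Measure X) (_ : IsProbabilityMeasure ν)
      (σ : X → Start n) (Ψ : X → Tensor n q → Tensor n q),
      MeasurePreserving (fun p : X × Tensor n q => (σ p.1, Ψ p.1 p.2))
        (ν.prod (gaussianTensor n q)) (μ.prod (gaussianTensor n q)) ∧
      (∀ x W, ∀ i < k, act (Ψ x W) (dir lam (σ x) (Ψ x 0) i) =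
        act (Ψ x 0) (dir lam (σ x) (Ψ x 0) i)) ∧
      (∀ x W v, (∀ i < k, inner ℝ (dir lam (σ x) (Ψ x 0) i) v = 0) →
        act (Ψ x W) v = act W v) := by
  induction k with
  | zero =>
    exact ⟨Start n, inferInstance, μ, inferInstance, id, fun _ W => W, MeasurePreserving.id _,
      by simp, by simp⟩
  | succ k ih =>
    obtain ⟨X, _, ν, _, σ, Ψ, hmp, hfix, hperp⟩ := ih
    -- The frozen responses determine the directions up to index k, so they do not depend on the
    -- remaining noise; 0 is just a reference value at which to read them.
    have hdir : ∀ x W, ∀ i ≤ k, dir lam (σ x) (Ψ x W) i = dir lam (σ x) (Ψ x 0) i := by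
      intro x W i hi
      exact (dir_congr hq lam (σ x) (fun j hj => (hfix x W j hj).symm) i hi).symm
    have hpair : Measurable fun x : X => (x, (0 : Tensor n q)) :=
      measurable_id.prodMk measurable_const
    have hσ : Measurable fun x : X => (σ x, Ψ x 0) := hmp.measurable.comp hpair
    have hdm' := (measurable_dir lam k).comp hσ
    simp only [Function.comp_def] at hdm'
    obtain ⟨d, hd⟩ : ∃ d : X → SlotSpace n q, d = fun x => dir lam (σ x) (Ψ x 0) k := ⟨_, rfl⟩
    have hdm : Measurable d := hd ▸ hdm'
    have hdx : ∀ x, d x = dir lam (σ x) (Ψ x 0) k := fun x => by rw [hd]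
    have hdn : ∀ x, ‖d x‖ = 0 ∨ ‖d x‖ = 1 := fun x => by
      rw [hdx]; exact norm_gramSchmidtNormed_eq _ _
    clear hdm' hd
    -- The frozen data gains one Gaussian vector, which becomes the response of the noise to
    -- direction k.
    refine ⟨X × EuclideanSpace ℝ (Fin n), inferInstance, ν.prod (stdGaussian _), inferInstance,
      fun x => σ x.1, fun x W => Ψ x.1 (resample hq (d x.1) x.2 W), ?_, ?_, ?_⟩
    · have h1 : MeasurePreserving
          (fun p : X × (EuclideanSpace ℝ (Fin n) × Tensor n q) =>
            (p.1, resample hq (d p.1) p.2.1 p.2.2))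
          (ν.prod ((stdGaussian _).prod (gaussianTensor n q))) (ν.prod (gaussianTensor n q)) := by
        refine (MeasurePreserving.id ν).skew_product
          (g := fun x (p : EuclideanSpace ℝ (Fin n) × Tensor n q) =>
            resample hq (d x) p.1 p.2) ?_ (.of_forall fun x => ?_)
        · exact (measurable_resample hq).comp
            ((hdm.comp measurable_fst).prodMk measurable_snd)
        · exact map_resample hq (hdn x)
      exact (hmp.comp h1).comp (measurePreserving_prodAssoc ν (stdGaussian _) (gaussianTensor n q))
    · rintro ⟨x, g⟩ W i hi
      simp only
      rw [hdir x _ i (by omega)]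
      rcases Nat.lt_succ_iff_lt_or_eq.1 hi with hi | rfl
      · rw [hfix x _ i hi, hfix x (resample hq (d x) g 0) i hi]
      -- On the newly frozen direction the response is the stored vector g, or 0 if the direction is
      -- degenerate; in both cases W drops out.
      · have hort : ∀ j < i, inner ℝ (dir lam (σ x) (Ψ x 0) j) (dir lam (σ x) (Ψ x 0) i) = 0 :=
          fun j hj => inner_gramSchmidtNormed_of_ne _ hj.ne
        rw [hperp x _ _ hort, hperp x _ _ hort, act_resample, act_resample, ← hdx,
          real_inner_self_eq_norm_sq]
        rcases hdn x with h | h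
        · have h' : d x = 0 := norm_eq_zero.1 h
          simp [h']
        · simp [h]
    · rintro ⟨x, g⟩ W v hv
      simp only at hv ⊢
      have hv' : ∀ i < k + 1, inner ℝ (dir lam (σ x) (Ψ x 0) i) v = 0 := by
        intro i hi
        rw [← hdir x (resample hq (d x) g 0) i (by omega)]
        exact hv i hi
      rw [hperp x _ v fun i hi => hv' i (by omega), act_resample]
      have : inner ℝ (d x) v = 0 := by rw [hdx]; exact hv' k (by omega)
      simp [this]

/-- The hypothesis on y says that it is determined by the past. Given the past, y is fixed and the
response to direction k is a standard Gaussian vector (or 0), so the conditional second moment is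
‖y‖² (or 0). -/
lemma lintegral_inner_act_dir_sq_le (hq : 1 ≤ q) (lam : ℝ) (μ : Measure (Start n))
    [IsProbabilityMeasure μ] (k : ℕ) {y : Start n × Tensor n q → EuclideanSpace ℝ (Fin n)}
    (hym : Measurable y)
    (hy : ∀ s W W', (∀ i < k, act W (dir lam s W i) = act W' (dir lam s W i)) →
      y (s, W) = y (s, W')) :
    ∫⁻ p, ENNReal.ofReal (inner ℝ (y p) (act p.2 (dir lam p.1 p.2 k)) ^ 2)
        ∂(μ.prod (gaussianTensor n q)) ≤
      ∫⁻ p, ENNReal.ofReal (‖y p‖ ^ 2) ∂(μ.prod (gaussianTensor n q)) := by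
  obtain ⟨X, _, ν, _, σ, Ψ, hmp, hfix, hperp⟩ := exists_decoupling hq lam μ k
  have hact : Measurable fun p : Start n × Tensor n q => act p.2 (dir lam p.1 p.2 k) :=
    measurable_act.comp (measurable_snd.prodMk (measurable_dir lam k))
  have hm1 : Measurable fun p : Start n × Tensor n q =>
      ENNReal.ofReal (inner ℝ (y p) (act p.2 (dir lam p.1 p.2 k)) ^ 2) :=
    ((hym.inner hact).pow_const 2).ennreal_ofReal
  have hm2 : Measurable fun p : Start n × Tensor n q => ENNReal.ofReal (‖y p‖ ^ 2) :=
    (hym.norm.pow_const 2).ennreal_ofReal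
  have hc1 := (hm1.comp hmp.measurable).aemeasurable (μ := ν.prod (gaussianTensor n q))
  have hc2 := (hm2.comp hmp.measurable).aemeasurable (μ := ν.prod (gaussianTensor n q))
  simp only [Function.comp_def] at hc1 hc2
  rw [← hmp.lintegral_comp hm1, ← hmp.lintegral_comp hm2, lintegral_prod _ hc1,
    lintegral_prod _ hc2]
  refine lintegral_mono fun x => ?_
  simp only
  have hdir : ∀ W, dir lam (σ x) (Ψ x W) k = dir lam (σ x) (Ψ x 0) k := fun W =>
    (dir_congr hq lam (σ x) (fun j hj => (hfix x W j hj).symm) k le_rfl).symm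
  have hy0 : ∀ W, y (σ x, Ψ x W) = y (σ x, Ψ x 0) := fun W =>
    (hy _ _ _ fun j hj => (hfix x W j hj).symm).symm
  have hort : ∀ j < k, inner ℝ (dir lam (σ x) (Ψ x 0) j) (dir lam (σ x) (Ψ x 0) k) = 0 :=
    fun j hj => inner_gramSchmidtNormed_of_ne _ hj.ne
  simp only [hdir, hy0, hperp x _ _ hort, lintegral_const, measure_univ, mul_one]
  set d := dir lam (σ x) (Ψ x 0) k
  rcases norm_gramSchmidtNormed_eq (query lam (σ x) (Ψ x 0)) k with h | h
  · have h' : d = 0 := norm_eq_zero.1 h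
    simp [h']
  · have hmd : Measurable fun W : Tensor n q => act W d :=
      measurable_act.comp (measurable_id.prodMk measurable_const)
    rw [← lintegral_inner_sq_stdGaussian, ← map_act hq (show ‖d‖ = 1 from h),
      lintegral_map (by fun_prop) hmd]

lemma lintegral_norm_act_dir_sq_le (hq : 1 ≤ q) (lam : ℝ) (μ : Measure (Start n))
    [IsProbabilityMeasure μ] (k : ℕ) :
    ∫⁻ p, ENNReal.ofReal (‖act p.2 (dir lam p.1 p.2 k)‖ ^ 2) ∂(μ.prod (gaussianTensor n q)) ≤
      n := by
  have hact : Measurable fun p : Start n × Tensor n q => act p.2 (dir lam p.1 p.2 k) :=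
    measurable_act.comp (measurable_snd.prodMk (measurable_dir lam k))
  have h : ∀ j : Fin n, ∫⁻ p, ENNReal.ofReal (inner ℝ (EuclideanSpace.single j (1 : ℝ))
      (act p.2 (dir lam p.1 p.2 k)) ^ 2) ∂(μ.prod (gaussianTensor n q)) ≤ 1 := fun j =>
    (lintegral_inner_act_dir_sq_le hq lam μ k measurable_const fun _ _ _ _ => rfl).trans
      (by simp)
  calc _ = ∑ j : Fin n, ∫⁻ p, ENNReal.ofReal (inner ℝ (EuclideanSpace.single j (1 : ℝ))
      (act p.2 (dir lam p.1 p.2 k)) ^ 2) ∂(μ.prod (gaussianTensor n q)) := by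
        rw [← lintegral_finsetSum]
        · refine lintegral_congr fun p => ?_
          rw [EuclideanSpace.real_norm_sq_eq, ENNReal.ofReal_sum_of_nonneg]
          · simp [EuclideanSpace.inner_single_left]
          · intro i _; positivity
        · intro j _
          exact ((measurable_const.inner hact).pow_const 2).ennreal_ofReal
    _ ≤ ∑ j : Fin n, 1 := Finset.sum_le_sum fun j _ => h j
    _ = n := by simp

/-- Conditionally on the past this is the concentration of ‖g‖². The factor ‖dir‖² makes the
deviation vanish on a degenerate direction. -/
lemma measure_norm_act_dir_sq_le (hq : 1 ≤ q) (lam : ℝ) (μ : Measure (Start n))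
    [IsProbabilityMeasure μ] (k : ℕ) {B : ENNReal} {c : ℝ} (hc : 0 < c)
    (hB : stdGaussian (EuclideanSpace ℝ (Fin n)) {g | c < |‖g‖ ^ 2 - n|} ≤ B) :
    (μ.prod (gaussianTensor n q)) {p | c <
      |‖act p.2 (dir lam p.1 p.2 k)‖ ^ 2 - n * ‖dir lam p.1 p.2 k‖ ^ 2|} ≤ B := by
  obtain ⟨X, _, ν, _, σ, Ψ, hmp, hfix, hperp⟩ := exists_decoupling hq lam μ k
  have hact : Measurable fun p : Start n × Tensor n q => act p.2 (dir lam p.1 p.2 k) :=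
    measurable_act.comp (measurable_snd.prodMk (measurable_dir lam k))
  have hms : MeasurableSet {p : Start n × Tensor n q | c <
      |‖act p.2 (dir lam p.1 p.2 k)‖ ^ 2 - n * ‖dir lam p.1 p.2 k‖ ^ 2|} := by
    refine measurableSet_lt measurable_const ?_
    exact continuous_abs.measurable.comp ((hact.norm.pow_const 2).sub
      (measurable_const.mul ((measurable_dir lam k).norm.pow_const 2)))
  rw [← hmp.measure_preimage hms.nullMeasurableSet, Measure.prod_apply (hmp.measurable hms)]
  refine (lintegral_mono fun x => ?_).trans (by simp : ∫⁻ _, B ∂ν ≤ B)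
  have hdir : ∀ W, dir lam (σ x) (Ψ x W) k = dir lam (σ x) (Ψ x 0) k := fun W =>
    (dir_congr hq lam (σ x) (fun j hj => (hfix x W j hj).symm) k le_rfl).symm
  have hort : ∀ j < k, inner ℝ (dir lam (σ x) (Ψ x 0) j) (dir lam (σ x) (Ψ x 0) k) = 0 :=
    fun j hj => inner_gramSchmidtNormed_of_ne _ hj.ne
  simp only [Set.preimage_ofPred_eq, hdir, hperp x _ _ hort]
  set d := dir lam (σ x) (Ψ x 0) k
  rcases norm_gramSchmidtNormed_eq (query lam (σ x) (Ψ x 0)) k with h | h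
  · have h' : d = 0 := norm_eq_zero.1 h
    simp [h', not_lt.2 hc.le]
  · have h' : ‖d‖ = 1 := h
    have hmd : Measurable fun W : Tensor n q => act W d :=
      measurable_act.comp (measurable_id.prodMk measurable_const)
    rw [← map_act hq h', Measure.map_apply hmd
      (measurableSet_lt (by fun_prop) (by fun_prop))] at hB
    simpa [h'] using hB

/-- The noise acts on the first `m` directions almost like an isometry scaled by `√n`, with images
almost orthogonal to the signal. -/
structure NearIsometry (lam : ℝ) (m : ℕ) (K δ : ℝ) (s : Start n) (W : Tensor n q) : Prop where
  signal : ∀ k < m, |inner ℝ s.1 (act W (dir lam s W k))| ≤ K * √(n : ℝ)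
  cross : ∀ k < m, ∀ i < k,
    |inner ℝ (act W (dir lam s W i)) (act W (dir lam s W k))| ≤ δ * n
  norm : ∀ k < m, |‖act W (dir lam s W k)‖ ^ 2 - n * ‖dir lam s W k‖ ^ 2| ≤ δ * n

/-- A union bound over three Chebyshev estimates, the second moments of ⟨u, W d_k⟩ and ⟨W d_i, W
d_k⟩ being at most n. Only the 1/K² term survives n → ∞; it is removed afterwards by K → ∞. -/
lemma exists_measure_not_nearIsometry_le : ∃ C : ℝ, ∀ {n q : ℕ}, 1 ≤ n → 1 ≤ q →
    ∀ (lam : ℝ) (m : ℕ) (K δ : ℝ), 0 < K → 0 < δ →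
    ∀ (μ : Measure (Start n)) [IsProbabilityMeasure μ], (∀ᵐ s ∂μ, ‖s.1‖ ^ 2 = n) →
    (μ.prod (gaussianTensor n q)) {p | ¬ NearIsometry lam m K δ p.1 p.2} ≤
      m * (ENNReal.ofReal (1 / K ^ 2) + (m * ENNReal.ofReal (1 / (δ ^ 2 * n)) +
        ENNReal.ofReal (C / (δ ^ 2 * n)))) := by
  obtain ⟨C, hC, hCn⟩ := exists_measure_norm_sq_stdGaussian_le
  refine ⟨C, fun {n q} hn hq lam m K δ hK hδ μ _ hμ => ?_⟩
  have hn0 : (0 : ℝ) < n := by exact_mod_cast hn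
  set Q := μ.prod (gaussianTensor n q)
  let w : ℕ → Start n × Tensor n q → EuclideanSpace ℝ (Fin n) :=
    fun k p => act p.2 (dir lam p.1 p.2 k)
  have hw : ∀ k, Measurable (w k) := fun k =>
    measurable_act.comp (measurable_snd.prodMk (measurable_dir lam k))
  have h1 : ∀ k, Q {p | K * √(n : ℝ) < |inner ℝ p.1.1 (w k p)|} ≤ ENNReal.ofReal (1 / K ^ 2) := by
    intro k
    have hE := lintegral_inner_act_dir_sq_le hq lam μ k
      (y := fun p => p.1.1) (by fun_prop) fun _ _ _ _ => rfl
    have hE2 : ∫⁻ p, ENNReal.ofReal (‖p.1.1‖ ^ 2) ∂Q = ENNReal.ofReal n := by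
      rw [lintegral_prod _ (by fun_prop)]
      simp only [lintegral_const, measure_univ, mul_one]
      rw [lintegral_congr_ae (g := fun _ => ENNReal.ofReal n)]
      · simp
      · filter_upwards [hμ] with s hs
        rw [hs]
    rw [hE2] at hE
    refine (measure_lt_abs_le Q (measurable_fst.fst.inner (hw k)).aemeasurable
      (by positivity) hE).trans_eq ?_
    rw [mul_pow, Real.sq_sqrt hn0.le]
    congr 1
    field_simp
  have h2 : ∀ k, ∀ i < k, Q {p | δ * n < |inner ℝ (w i p) (w k p)|} ≤
      ENNReal.ofReal (1 / (δ ^ 2 * n)) := by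
    intro k i hik
    have hE := (lintegral_inner_act_dir_sq_le hq lam μ k (y := w i) (hw i)
      fun s W W' h => by
        simp only [w]
        rw [h i hik, dir_congr hq lam s h i hik.le]).trans (lintegral_norm_act_dir_sq_le hq lam μ i)
    rw [← ENNReal.ofReal_natCast] at hE
    refine (measure_lt_abs_le Q ((hw i).inner (hw k)).aemeasurable
      (by positivity) hE).trans_eq ?_
    congr 1
    field_simp
  have h3 : ∀ k, Q {p | δ * n < |‖w k p‖ ^ 2 - n * ‖dir lam p.1 p.2 k‖ ^ 2|} ≤
      ENNReal.ofReal (C / (δ ^ 2 * n)) := fun k =>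
    measure_norm_act_dir_sq_le hq lam μ k (by positivity) (hCn n δ hn hδ)
  have hsub : {p : Start n × Tensor n q | ¬ NearIsometry lam m K δ p.1 p.2} ⊆
      ⋃ k ∈ Finset.range m, ({p | K * √(n : ℝ) < |inner ℝ p.1.1 (w k p)|} ∪
        ((⋃ i ∈ Finset.range k, {p | δ * n < |inner ℝ (w i p) (w k p)|}) ∪
          {p | δ * n < |‖w k p‖ ^ 2 - n * ‖dir lam p.1 p.2 k‖ ^ 2|})) := by
    intro p hp
    by_contra hcon
    simp only [Set.mem_iUnion, Set.mem_union, Set.mem_ofPred_eq, not_exists, not_or, not_lt,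
      Finset.mem_range] at hcon
    exact hp ⟨fun k hk => (hcon k hk).1, fun k hk i hi => (hcon k hk).2.1 i hi,
      fun k hk => (hcon k hk).2.2⟩
  refine (measure_mono hsub).trans ((measure_biUnion_finset_le _ _).trans ?_)
  refine (Finset.sum_le_card_nsmul _ _ (ENNReal.ofReal (1 / K ^ 2) +
    (m * ENNReal.ofReal (1 / (δ ^ 2 * n)) + ENNReal.ofReal (C / (δ ^ 2 * n)))) ?_).trans_eq
      (by rw [Finset.card_range, nsmul_eq_mul])
  intro k hk
  refine (measure_union_le _ _).trans (add_le_add (h1 k) ((measure_union_le _ _).trans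
    (add_le_add ?_ (h3 k))))
  refine (measure_biUnion_finset_le _ _).trans ?_
  refine (Finset.sum_le_card_nsmul _ _ (ENNReal.ofReal (1 / (δ ^ 2 * n))) fun i hi =>
    h2 k i (Finset.mem_range.1 hi)).trans ?_
  rw [Finset.card_range, nsmul_eq_mul]
  gcongr
  exact (Finset.mem_range.1 hk).le

end

/-! ### Deterministic asymptotics of the cosine recursion. -/

/-- The geometric sum `1 + (q - 1) + ⋯ + (q - 1) ^ (k - 1)`. -/
def geomSum (q k : ℕ) : ℕ := ∑ j ∈ Finset.range k, (q - 1) ^ j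

lemma geomSum_succ (q k : ℕ) : geomSum q (k + 1) = 1 + (q - 1) * geomSum q k := by
  rw [geomSum, geomSum, Finset.sum_range_succ', Finset.mul_sum, add_comm]
  simp [pow_succ']

lemma geomSum_strictMono {q : ℕ} (hq : 2 ≤ q) : StrictMono (geomSum q) := by
  refine strictMono_nat_of_lt_succ fun k => ?_
  rw [geomSum, geomSum, Finset.sum_range_succ]
  have : 0 < (q - 1) ^ k := pow_pos (by omega) k
  omega

lemma epsilon_eq {q p : ℕ} (hq : 2 ≤ q) : epsilon q p = 1 / (geomSum q p : ℝ) := by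
  rw [epsilon, geomSum]
  split_ifs with h
  · subst h; simp
  · have hq' : ((q - 1 : ℕ) : ℝ) = (q : ℝ) - 1 := by
      rw [Nat.cast_sub (by omega), Nat.cast_one]
    have h2 : (2 : ℝ) < q := by exact_mod_cast (by omega : 2 < q)
    push_cast
    rw [hq', geom_sum_eq (by linarith), one_div_div]
    congr 1
    ring

/-- One step of power iteration, in terms of the cosines between the iterates and the signal. -/
def IsCosineStep (lam : ℝ) (n q : ℕ) (b κ ρ ρ' : ℝ) : Prop :=
  ρ' = (lam * ρ ^ (q - 1) + b / √(n : ℝ)) /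
    √((lam * ρ ^ (q - 1) + b / √(n : ℝ)) ^ 2 + (κ - b ^ 2 / n))

/-- The fluctuations b are only assumed bounded, since they disappear in the limit; only κ has to
converge. Working along a sequence N of dimensions allows passage to subsequences. -/
lemma tendsto_cosine {q p : ℕ} (hq : 2 ≤ q) (hp : 1 ≤ p) {lam : ℕ → ℝ} {Λ : ℝ}
    (hlim : Tendsto (fun n : ℕ => lam n / (n : ℝ) ^ (((q : ℝ) - 2 + epsilon q p) / 2))
      atTop (𝓝 Λ))
    {N : ℕ → ℕ} (hN : Tendsto N atTop atTop) {ρ b κ : ℕ → ℕ → ℝ} {m K : ℝ}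
    (hm : Tendsto (fun j => √(N j : ℝ) * ρ j 0) atTop (𝓝 m))
    (hb : ∀ j, ∀ k < p, |b j k| ≤ K)
    (hκ : ∀ k < p, Tendsto (fun j => κ j k) atTop (𝓝 1))
    (hstep : ∀ j, ∀ k < p, IsCosineStep (lam (N j)) (N j) q (b j k) (κ j k) (ρ j k) (ρ j (k + 1))) :
    Tendsto (fun j => ρ j p) atTop
      (𝓝 (Real.sin (Real.arctan (Λ ^ geomSum q p * m ^ ((q - 1) ^ p))))) := by
  have hNR : Tendsto (fun j => (N j : ℝ)) atTop atTop := tendsto_natCast_atTop_atTop.comp hN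
  have hNpos : ∀ᶠ j in atTop, 0 < (N j : ℝ) := hNR.eventually_gt_atTop 0
  set ε := epsilon q p with hε
  have hsp : 0 < (geomSum q p : ℝ) := by
    have := geomSum_strictMono hq (show 0 < p by omega)
    exact_mod_cast (by omega : 0 < geomSum q p)
  have hεs : ε * geomSum q p = 1 := by
    rw [hε, epsilon_eq hq]; field_simp
  have hε0 : 0 < ε := by rw [hε, epsilon_eq hq]; positivity
  have hεk : ∀ k < p, ε * geomSum q k < 1 := by
    intro k hk
    rw [← hεs]
    have : (geomSum q k : ℝ) < geomSum q p := by exact_mod_cast geomSum_strictMono hq hk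
    gcongr
  have hq1 : ((q - 1 : ℕ) : ℝ) = (q : ℝ) - 1 := by
    rw [Nat.cast_sub (by omega), Nat.cast_one]
  have hL := hlim.comp hN
  have hneg : ∀ {x : ℝ}, 0 < x → Tendsto (fun j => (N j : ℝ) ^ (-x)) atTop (𝓝 0) := fun hx =>
    (tendsto_rpow_neg_atTop hx).comp hNR
  have hbz : ∀ k < p, ∀ {x : ℝ}, 0 < x →
      Tendsto (fun j => b j k * (N j : ℝ) ^ (-x)) atTop (𝓝 0) := by
    intro k hk x hx
    refine bdd_le_mul_tendsto_zero' K (.of_forall fun j => hb j k hk) (hneg hx)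
  have hdiv : ∀ {y x a : ℝ}, 0 < y → x / y ^ a = x * y ^ (-a) := fun hy => by
    rw [Real.rpow_neg hy.le, div_eq_mul_inv]
  -- the numerators of the cosines, rescaled
  let τ : ℕ → ℕ → ℝ := fun k j =>
    lam (N j) * ρ j k ^ (q - 1) + b j k / √(N j : ℝ)
  have hχ : ∀ k < p, Tendsto
      (fun j => ρ j k * (N j : ℝ) ^ ((1 - ε * geomSum q k) / 2)) atTop
        (𝓝 (Λ ^ geomSum q k * m ^ ((q - 1) ^ k))) →
      Tendsto (fun j => τ k j * (N j : ℝ) ^ ((1 - ε * geomSum q (k + 1)) / 2)) atTop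
        (𝓝 (Λ ^ geomSum q (k + 1) * m ^ ((q - 1) ^ (k + 1)))) := by
    intro k hk hA
    -- After rescaling, b/√n carries the factor n^(-ε s_{k+1}/2), which tends to 0 because s_{k+1} >
    -- 0.
    have hs : 0 < ε * geomSum q (k + 1) / 2 := by
      have := geomSum_strictMono hq (show 0 < k + 1 by omega)
      have : 0 < (geomSum q (k + 1) : ℝ) := by exact_mod_cast (by omega : 0 < geomSum q (k + 1))
      positivity
    have h := (hL.mul (hA.pow (q - 1))).add (hbz k hk hs)
    have hval : Λ * (Λ ^ geomSum q k * m ^ ((q - 1) ^ k)) ^ (q - 1) + 0 =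
        Λ ^ geomSum q (k + 1) * m ^ ((q - 1) ^ (k + 1)) := by
      rw [geomSum_succ]
      ring
    rw [hval] at h
    refine h.congr' ?_
    filter_upwards [hNpos] with j hj
    simp only [Function.comp, τ]
    rw [add_mul, mul_pow, ← Real.rpow_natCast ((N j : ℝ) ^ ((1 - ε * geomSum q k) / 2)),
      ← Real.rpow_mul hj.le, Real.sqrt_eq_rpow, hdiv hj, hdiv hj]
    congr 1
    -- Balance of exponents: -(q - 2 + ε) + (q - 1)(1 - ε s_k) = 1 - ε (1 + (q - 1) s_k) = 1 - ε
    -- s_{k+1}.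
    · have : (N j : ℝ) ^ (-(((q : ℝ) - 2 + ε) / 2)) *
          (N j : ℝ) ^ ((1 - ε * geomSum q k) / 2 * ((q - 1 : ℕ) : ℝ)) =
          (N j : ℝ) ^ ((1 - ε * geomSum q (k + 1)) / 2) := by
        rw [← Real.rpow_add hj, geomSum_succ]
        congr 1
        push_cast
        rw [hq1]
        ring
      rw [← this]
      ring
    · rw [mul_assoc, ← Real.rpow_add hj]
      congr 2
      ring
  have hden : ∀ k < p, ∀ t : ℝ, Tendsto (fun j => τ k j) atTop (𝓝 t) →
      Tendsto (fun j => √(τ k j ^ 2 + (κ j k - b j k ^ 2 / N j))) atTop (𝓝 √(t ^ 2 + 1)) := by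
    intro k hk t ht
    have h0 : Tendsto (fun j => b j k ^ 2 / N j) atTop (𝓝 0) := by
      have := (hbz k hk (x := 1 / 2) (by norm_num)).pow 2
      simp only [ne_eq, OfNat.ofNat_ne_zero, not_false_eq_true, zero_pow] at this
      refine this.congr' ?_
      filter_upwards [hNpos] with j hj
      rw [mul_pow, ← Real.rpow_natCast ((N j : ℝ) ^ _), ← Real.rpow_mul hj.le,
        show -(1 / 2 : ℝ) * ((2 : ℕ) : ℝ) = -1 by norm_num, Real.rpow_neg_one, div_eq_mul_inv]
    have := ((ht.pow 2).add ((hκ k hk).sub h0)).sqrt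
    simpa using this
  have hA : ∀ k < p, Tendsto
      (fun j => ρ j k * (N j : ℝ) ^ ((1 - ε * geomSum q k) / 2)) atTop
        (𝓝 (Λ ^ geomSum q k * m ^ ((q - 1) ^ k))) := by
    intro k
    induction k with
    | zero =>
      intro _
      simpa [geomSum, Real.sqrt_eq_rpow, mul_comm] using hm
    | succ k ih =>
      intro hk
      have hk' : k < p := by omega
      have h1 := hχ k hk' (ih hk')
      have hpos : 0 < (1 - ε * geomSum q (k + 1)) / 2 := by
        have := hεk (k + 1) hk
        linarith
      -- Before the last step the numerator still vanishes, so the denominator tends to 1 and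
      -- normalization has no effect on the leading order.
      have hτ : Tendsto (fun j => τ k j) atTop (𝓝 0) := by
        have := h1.mul (hneg hpos)
        rw [mul_zero] at this
        refine this.congr' ?_
        filter_upwards [hNpos] with j hj
        rw [mul_assoc, ← Real.rpow_add hj]
        simp
      have h2 := h1.div (hden k hk' 0 hτ) (by simp)
      simp only [ne_eq, OfNat.ofNat_ne_zero, not_false_eq_true, zero_pow, zero_add,
        Real.sqrt_one, div_one] at h2
      refine h2.congr fun j => ?_
      have := hstep j k hk'
      rw [IsCosineStep] at this
      simp only [Pi.div_apply, τ]
      rw [this]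
      ring
  obtain ⟨k, rfl⟩ : ∃ k, p = k + 1 := ⟨p - 1, by omega⟩
  have h1 := hχ k (by omega) (hA k (by omega))
  rw [hεs] at h1
  simp only [sub_self, zero_div, Real.rpow_zero, mul_one] at h1
  have h2 := h1.div (hden k (by omega) _ h1) (by positivity)
  rw [Real.sin_arctan, add_comm 1]
  exact h2.congr fun j => (hstep j k (by omega)).symm

/-- Compactness: counterexamples with δ → 0 and n → ∞ have bounded √n ρ_0, so a subsequence of it
converges and `tendsto_cosine` contradicts them. -/
lemma exists_forall_cosine_close {q p : ℕ} (hq : 2 ≤ q) (hp : 1 ≤ p) {lam : ℕ → ℝ} {Λ : ℝ}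
    (hlim : Tendsto (fun n : ℕ => lam n / (n : ℝ) ^ (((q : ℝ) - 2 + epsilon q p) / 2))
      atTop (𝓝 Λ)) (K : ℝ) {η : ℝ} (hη : 0 < η) :
    ∃ δ > 0, ∃ N : ℕ, ∀ n ≥ N, ∀ ρ b κ : ℕ → ℝ, |√(n : ℝ) * ρ 0| ≤ K → (∀ k < p, |b k| ≤ K) →
      (∀ k < p, |κ k - 1| ≤ δ) →
      (∀ k < p, IsCosineStep (lam n) n q (b k) (κ k) (ρ k) (ρ (k + 1))) →
      |ρ p - Real.sin (Real.arctan (Λ ^ geomSum q p * (√(n : ℝ) * ρ 0) ^ ((q - 1) ^ p)))| < η := by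
  by_contra! hcon
  choose N hNj ρ b κ hm hb hκ hstep hfar using fun j : ℕ =>
    hcon (1 / ((j : ℝ) + 1)) (by positivity) j
  have hN : Tendsto N atTop atTop := tendsto_atTop_mono hNj tendsto_id
  obtain ⟨m, -, φ, hφ, hφm⟩ := (isCompact_Icc (a := -K) (b := K)).tendsto_subseq
    (x := fun j => √(N j : ℝ) * ρ j 0) fun j => abs_le.1 (hm j)
  have hκ' : ∀ k < p, Tendsto (fun j => κ (φ j) k) atTop (𝓝 1) := by
    intro k hk
    have h0 : Tendsto (fun j => κ j k - 1) atTop (𝓝 0) :=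
      squeeze_zero_norm (fun j => hκ j k hk) tendsto_one_div_add_atTop_nhds_zero_nat
    have := (h0.add_const 1).comp hφ.tendsto_atTop
    simpa [Function.comp_def] using this
  have h1 := tendsto_cosine hq hp hlim (hN.comp hφ.tendsto_atTop) (ρ := fun j => ρ (φ j))
    (b := fun j => b (φ j)) (κ := fun j => κ (φ j)) hφm (fun j => hb (φ j)) hκ'
    (fun j => hstep (φ j))
  have h2 : Tendsto (fun j => Real.sin (Real.arctan
      (Λ ^ geomSum q p * (√(N (φ j) : ℝ) * ρ (φ j) 0) ^ ((q - 1) ^ p)))) atTop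
      (𝓝 (Real.sin (Real.arctan (Λ ^ geomSum q p * m ^ ((q - 1) ^ p))))) := by
    have hc : Continuous fun x : ℝ =>
        Real.sin (Real.arctan (Λ ^ geomSum q p * x ^ ((q - 1) ^ p))) := by fun_prop
    exact (hc.tendsto m).comp hφm
  have h3 := (h1.sub h2).abs
  rw [sub_self, abs_zero] at h3
  obtain ⟨j, hj⟩ := (h3.eventually_lt_const hη).exists
  exact absurd (hfar (φ j)) (not_le.2 hj)

/-! ### From the near-isometry event to the cosine recursion. -/

section

variable {n q : ℕ}

lemma abs_inner_dir_query_le (lam : ℝ) (s : Start n) (W : Tensor n q) (k i : ℕ) :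
    |inner ℝ (dir lam s W i) (query lam s W k)| ≤ ‖query lam s W k‖ := by
  refine (abs_real_inner_le_norm _ _).trans ?_
  rcases norm_gramSchmidtNormed_eq (query lam s W) i with h | h <;>
  · change ‖dir lam s W i‖ = _ at h
    rw [h]
    simp

lemma NearIsometry.abs_inner_signal_le {lam : ℝ} {m : ℕ} {K δ : ℝ} {s : Start n} {W : Tensor n q}
    (h : NearIsometry lam m K δ s W) (hK : 0 ≤ K) {k : ℕ} (hk : k < m) :
    |inner ℝ s.1 (act W (query lam s W k))| ≤ m * K * √(n : ℝ) * ‖query lam s W k‖ := by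
  conv_lhs => rw [query_eq_sum]
  rw [map_sum, inner_sum]
  calc _ ≤ ∑ i ∈ Finset.range (k + 1), ‖query lam s W k‖ * (K * √(n : ℝ)) := by
        refine (Finset.abs_sum_le_sum_abs _ _).trans (Finset.sum_le_sum fun i hi => ?_)
        rw [Finset.mem_range] at hi
        rw [map_smul, inner_smul_right, abs_mul]
        exact mul_le_mul (abs_inner_dir_query_le _ _ _ _ _) (h.signal i (by omega)) (abs_nonneg _)
          (norm_nonneg _)
    _ = ((k + 1 : ℕ) : ℝ) * (‖query lam s W k‖ * (K * √(n : ℝ))) := by simp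
    _ ≤ m * (‖query lam s W k‖ * (K * √(n : ℝ))) := by
        gcongr
        exact hk
    _ = _ := by ring

/-- Expand the query in the directions: both squared norms are quadratic forms in the same
coefficients, and the two Gram matrices differ entrywise by at most δn. Bounding each coefficient by
the norm of the query costs the factor m². -/
lemma NearIsometry.abs_norm_sq_sub_le {lam : ℝ} {m : ℕ} {K δ : ℝ} {s : Start n} {W : Tensor n q}
    (h : NearIsometry lam m K δ s W) (hδ : 0 ≤ δ) {k : ℕ} (hk : k < m) :
    |‖act W (query lam s W k)‖ ^ 2 - n * ‖query lam s W k‖ ^ 2| ≤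
      m ^ 2 * δ * n * ‖query lam s W k‖ ^ 2 := by
  set c : ℕ → ℝ := fun i => inner ℝ (dir lam s W i) (query lam s W k)
  have hc : ∀ i, |c i| ≤ ‖query lam s W k‖ := abs_inner_dir_query_le _ _ _ _
  set y : ℕ → EuclideanSpace ℝ (Fin n) := fun i => act W (dir lam s W i)
  have h1 : ‖act W (query lam s W k)‖ ^ 2 =
      ∑ i ∈ Finset.range (k + 1), ∑ j ∈ Finset.range (k + 1), c i * c j * inner ℝ (y i) (y j) := by
    conv_lhs => rw [query_eq_sum, map_sum, ← real_inner_self_eq_norm_sq]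
    rw [sum_inner]
    refine Finset.sum_congr rfl fun i _ => ?_
    rw [inner_sum]
    refine Finset.sum_congr rfl fun j _ => ?_
    rw [map_smul, map_smul, real_inner_smul_left, real_inner_smul_right]
    ring
  have h2 : n * ‖query lam s W k‖ ^ 2 =
      ∑ i ∈ Finset.range (k + 1), ∑ j ∈ Finset.range (k + 1),
        c i * c j * (n * inner ℝ (dir lam s W i) (dir lam s W j)) := by
    conv_lhs => rw [query_eq_sum, ← real_inner_self_eq_norm_sq]
    rw [sum_inner, Finset.mul_sum]
    refine Finset.sum_congr rfl fun i _ => ?_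
    rw [inner_sum, Finset.mul_sum]
    refine Finset.sum_congr rfl fun j _ => ?_
    rw [real_inner_smul_left, real_inner_smul_right]
    ring
  have h3 : ∀ i < m, ∀ j < m,
      |inner ℝ (y i) (y j) - n * inner ℝ (dir lam s W i) (dir lam s W j)| ≤ δ * n := by
    intro i hi j hj
    rcases lt_trichotomy i j with hij | rfl | hij
    · have h0 : inner ℝ (dir lam s W i) (dir lam s W j) = 0 :=
        inner_gramSchmidtNormed_of_ne _ hij.ne
      rw [h0, mul_zero, sub_zero]
      exact h.cross j hj i hij
    · rw [real_inner_self_eq_norm_sq, real_inner_self_eq_norm_sq]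
      exact h.norm i hi
    · have h0 : inner ℝ (dir lam s W i) (dir lam s W j) = 0 :=
        inner_gramSchmidtNormed_of_ne _ hij.ne'
      rw [h0, mul_zero, sub_zero, real_inner_comm]
      exact h.cross i hi j hij
  rw [h1, h2, ← Finset.sum_sub_distrib]
  calc _ ≤ ∑ i ∈ Finset.range (k + 1), ∑ j ∈ Finset.range (k + 1),
        ‖query lam s W k‖ * ‖query lam s W k‖ * (δ * n) := by
        refine (Finset.abs_sum_le_sum_abs _ _).trans (Finset.sum_le_sum fun i hi => ?_)
        rw [← Finset.sum_sub_distrib]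
        refine (Finset.abs_sum_le_sum_abs _ _).trans (Finset.sum_le_sum fun j hj => ?_)
        rw [Finset.mem_range] at hi hj
        rw [← mul_sub, abs_mul, abs_mul]
        exact mul_le_mul (mul_le_mul (hc i) (hc j) (abs_nonneg _) (norm_nonneg _))
          (h3 i (by omega) j (by omega)) (abs_nonneg _) (by positivity)
    _ = ((k + 1 : ℕ) : ℝ) ^ 2 * (‖query lam s W k‖ * ‖query lam s W k‖ * (δ * n)) := by
        simp only [Finset.sum_const, Finset.card_range, nsmul_eq_mul]
        ring
    _ ≤ (m : ℝ) ^ 2 * (‖query lam s W k‖ * ‖query lam s W k‖ * (δ * n)) := by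
        gcongr
        exact hk
    _ = _ := by ring

/-- The cosine of the angle between `x` and a vector `u` of norm `√n`. -/
def cosine (x u : EuclideanSpace ℝ (Fin n)) : ℝ := inner ℝ x u / (‖x‖ * √(n : ℝ))

lemma cosine_smul {c : ℝ} (hc : 0 < c) (x u : EuclideanSpace ℝ (Fin n)) :
    cosine (c • x) u = cosine x u := by
  rw [cosine, cosine, real_inner_smul_left, norm_smul, Real.norm_of_nonneg hc.le, mul_assoc,
    mul_div_mul_left _ _ hc.ne']

/-- Pythagoras along u: with b = ⟨u, w⟩/√n, the term ‖w‖²/n - b²/n is the normalized squared norm of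
the part of w orthogonal to u. -/
lemma cosine_signal_add_noise (hn : 1 ≤ n) {u w : EuclideanSpace ℝ (Fin n)} (hu : ‖u‖ ^ 2 = n)
    (α : ℝ) :
    ‖α • u + w‖ ^ 2 / n = (α + inner ℝ u w / √(n : ℝ) / √(n : ℝ)) ^ 2 +
        (‖w‖ ^ 2 / n - (inner ℝ u w / √(n : ℝ)) ^ 2 / n) ∧
    cosine (α • u + w) u = (α + inner ℝ u w / √(n : ℝ) / √(n : ℝ)) /
      √((α + inner ℝ u w / √(n : ℝ) / √(n : ℝ)) ^ 2 +
        (‖w‖ ^ 2 / n - (inner ℝ u w / √(n : ℝ)) ^ 2 / n)) := by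
  have hn0 : (0 : ℝ) < n := by exact_mod_cast hn
  have hss : √(n : ℝ) * √(n : ℝ) = n := Real.mul_self_sqrt hn0.le
  have hb : inner ℝ u w / √(n : ℝ) / √(n : ℝ) = inner ℝ u w / n := by
    rw [div_div, hss]
  have h1 : ‖α • u + w‖ ^ 2 / n = (α + inner ℝ u w / √(n : ℝ) / √(n : ℝ)) ^ 2 +
        (‖w‖ ^ 2 / n - (inner ℝ u w / √(n : ℝ)) ^ 2 / n) := by
    rw [hb, div_pow, Real.sq_sqrt hn0.le, norm_add_sq_real, norm_smul, mul_pow, hu,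
      real_inner_smul_left, Real.norm_eq_abs, sq_abs]
    field_simp
    ring
  refine ⟨h1, ?_⟩
  rw [← h1, hb, Real.sqrt_div (by positivity), Real.sqrt_sq (norm_nonneg _), cosine,
    inner_add_left, real_inner_smul_left, real_inner_self_eq_norm_sq, hu, real_inner_comm]
  rw [div_div_eq_mul_div, ← div_div, div_right_comm]
  congr 1
  rw [div_eq_iff (by positivity)]
  rw [mul_assoc, hss]
  field_simp

lemma NearIsometry.cosine_step (hn : 1 ≤ n) (hq : 1 ≤ q) {lam : ℝ} {m : ℕ} {K δ : ℝ}
    {s : Start n} {W : Tensor n q} (h : NearIsometry lam m K δ s W) (hK : 0 ≤ K) (hδ : 0 ≤ δ)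
    (hδ' : m ^ 2 * δ ≤ 1 / 2) (hKn : (m * K) ^ 2 < n / 2) (hu : ‖s.1‖ ^ 2 = n) {k : ℕ} (hk : k < m)
    (hx : traj lam s W k ≠ 0) :
    ‖traj lam s W (k + 1)‖ = √(n : ℝ) ∧ ∃ b κ : ℝ, |b| ≤ m * K ∧ |κ - 1| ≤ m ^ 2 * δ ∧
      IsCosineStep lam n q b κ (cosine (traj lam s W k) s.1)
        (cosine (traj lam s W (k + 1)) s.1) := by
  have hn0 : (0 : ℝ) < n := by exact_mod_cast hn
  have hsn : 0 < √(n : ℝ) := Real.sqrt_pos.2 hn0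
  set x := traj lam s W k with hxdef
  set B := ‖query lam s W k‖ with hBdef
  have hB : B = ‖x‖ ^ (q - 1) := norm_tensorPower x
  have hx0 : 0 < ‖x‖ := norm_pos_iff.2 hx
  have hB0 : 0 < B := by rw [hB]; positivity
  set w := B⁻¹ • act W (query lam s W k) with hw
  set b := inner ℝ s.1 w / √(n : ℝ) with hb
  set κ := ‖w‖ ^ 2 / n with hκ
  set α := lam * cosine x s.1 ^ (q - 1) with hα
  have hbK : |b| ≤ m * K := by
    have := h.abs_inner_signal_le hK hk
    rw [hb, hw, inner_smul_right, abs_div, abs_mul, abs_of_pos hsn, abs_of_pos (inv_pos.2 hB0),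
      div_le_iff₀ hsn, inv_mul_le_iff₀ hB0]
    linarith
  have hκδ : |κ - 1| ≤ m ^ 2 * δ := by
    have := h.abs_norm_sq_sub_le hδ hk
    have h2 : κ - 1 = (‖act W (query lam s W k)‖ ^ 2 - n * B ^ 2) / (n * B ^ 2) := by
      rw [hκ, hw, norm_smul, norm_inv, Real.norm_of_nonneg hB0.le]
      field_simp
    rw [h2, abs_div, abs_of_pos (show 0 < n * B ^ 2 by positivity), div_le_iff₀ (by positivity)]
    linarith
  obtain ⟨hy, hcos⟩ := cosine_signal_add_noise hn (w := w) hu α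
  rw [← hb, ← hκ] at hy hcos
  -- The normalization must not divide by zero: κ ≥ 1/2 and b²/n < 1/2 leave a nonzero component
  -- orthogonal to u.
  have hypos : 0 < ‖α • s.1 + w‖ := by
    have h1 : b ^ 2 / n < 1 / 2 := by
      rw [div_lt_iff₀ hn0]
      calc b ^ 2 = |b| ^ 2 := (sq_abs b).symm
        _ ≤ (m * K) ^ 2 := by gcongr
        _ < _ := by linarith
    have h2 : 1 / 2 ≤ κ := by
      have := (abs_le.1 hκδ).1
      linarith
    have h3 : 0 < ‖α • s.1 + w‖ ^ 2 / n := by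
      rw [hy]
      nlinarith [sq_nonneg (α + b / √(n : ℝ))]
    by_contra hcon
    have h4 : ‖α • s.1 + w‖ = 0 := le_antisymm (not_lt.1 hcon) (norm_nonneg _)
    rw [h4] at h3
    simp at h3
  obtain ⟨z, hz, hsucc⟩ := traj_succ hq lam s W k
  -- Substituting ⟨u, x⟩ = ρ ‖x‖ √n, the power n^(q/2) cancels up to 1/√n.
  have hzy : z = (B / √(n : ℝ)) • (α • s.1 + w) := by
    rw [hz, smul_add, smul_smul, hw, smul_smul]
    congr 2
    · obtain ⟨t, rfl⟩ : ∃ t, q = t + 1 := ⟨q - 1, by omega⟩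
      have hpow : (n : ℝ) ^ (((t + 1 : ℕ) : ℝ) / 2) = √(n : ℝ) ^ (t + 1) := by
        rw [Real.sqrt_eq_rpow, ← Real.rpow_natCast, ← Real.rpow_mul hn0.le]
        congr 1
        ring
      have hin : inner ℝ s.1 x = cosine x s.1 * (‖x‖ * √(n : ℝ)) := by
        rw [cosine, div_mul_cancel₀ _ (by positivity), real_inner_comm]
      rw [hpow, hin, hα, hB]
      simp only [Nat.add_sub_cancel, mul_pow, pow_succ]
      field_simp
    · field_simp
  have hzpos : 0 < ‖z‖ := by
    rw [hzy, norm_smul]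
    exact mul_pos (norm_pos_iff.2 (by positivity)) hypos
  refine ⟨?_, b, κ, hbK, hκδ, ?_⟩
  · rw [hsucc, norm_smul, Real.norm_of_nonneg (by positivity), div_mul_cancel₀ _ hzpos.ne']
  · rw [hsucc, cosine_smul (by positivity), hzy, cosine_smul (by positivity), hcos, IsCosineStep]

/-- On the event that the noise is a near isometry, the final overlap is close to the limit
profile evaluated at the initial overlap. -/
lemma exists_forall_overlap_close {p : ℕ} (hq : 2 ≤ q) (hp : 1 ≤ p) {lam : ℕ → ℝ} {Λ : ℝ}
    (hlim : Tendsto (fun n : ℕ => lam n / (n : ℝ) ^ (((q : ℝ) - 2 + epsilon q p) / 2))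
      atTop (𝓝 Λ)) {K : ℝ} (hK : 0 ≤ K) {η : ℝ} (hη : 0 < η) :
    ∃ δ > 0, ∀ᶠ n : ℕ in atTop, ∀ (s : Start n) (W : Tensor n q),
      NearIsometry (lam n) p K δ s W → ‖s.1‖ ^ 2 = n → ‖s.2‖ = 1 → |inner ℝ s.2 s.1| ≤ K →
      |overlap (traj (lam n) s W p) s.1 -
        Real.sin (Real.arctan (Λ ^ geomSum q p * inner ℝ s.2 s.1 ^ ((q - 1) ^ p)))| < η := by
  obtain ⟨δ, hδ, N, hN⟩ := exists_forall_cosine_close hq hp hlim (p * K) hη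
  have hp0 : (0 : ℝ) < p := by exact_mod_cast hp
  have hp1 : (1 : ℝ) ≤ p := by exact_mod_cast hp
  -- Dividing by p² absorbs the loss in `NearIsometry.abs_norm_sq_sub_le`; the 1/2 keeps the
  -- iterates nonzero.
  refine ⟨min δ (1 / 2) / p ^ 2, by positivity, ?_⟩
  filter_upwards [eventually_ge_atTop N, eventually_ge_atTop 1,
    tendsto_natCast_atTop_atTop.eventually_gt_atTop (2 * (p * K) ^ 2)] with n hnN hn hnK
  intro s W h hu hx0 hM
  have hn0 : (0 : ℝ) < n := by exact_mod_cast hn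
  have hδ' : (p : ℝ) ^ 2 * (min δ (1 / 2) / p ^ 2) = min δ (1 / 2) := by field_simp
  have hstep := fun k (hk : k < p) => h.cosine_step hn (by omega) hK (by positivity)
    (by rw [hδ']; exact min_le_right _ _) (by linarith) hu hk
  rw [hδ'] at hstep
  have hne : ∀ k ≤ p, traj (lam n) s W k ≠ 0 := by
    intro k
    induction k with
    | zero =>
      intro _ h0
      have : s.2 = 0 := h0
      simp [this] at hx0
    | succ k ih =>
      intro hk
      rw [← norm_pos_iff, (hstep k (by omega) (ih (by omega))).1]
      exact Real.sqrt_pos.2 hn0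
  choose! b κ hb hκ hcos using fun k (hk : k < p) => (hstep k hk (hne k hk.le)).2
  have hM0 : √(n : ℝ) * cosine (traj (lam n) s W 0) s.1 = inner ℝ s.2 s.1 := by
    change √(n : ℝ) * cosine s.2 s.1 = _
    rw [cosine, hx0, one_mul, mul_div_cancel₀ _ (Real.sqrt_pos.2 hn0).ne']
  have hfin := hN n hnN (fun k => cosine (traj (lam n) s W k) s.1) b κ
    (by
      rw [hM0]
      refine hM.trans ?_
      nlinarith)
    hb (fun k hk => (hκ k hk).trans (min_le_left _ _)) hcos
  rw [hM0] at hfin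
  -- The overlap is a cosine because ‖x_p‖ = √n, which needs p ≥ 1: the start has norm 1.
  have hov : overlap (traj (lam n) s W p) s.1 = cosine (traj (lam n) s W p) s.1 := by
    obtain ⟨k, rfl⟩ : ∃ k, p = k + 1 := ⟨p - 1, by omega⟩
    rw [overlap, cosine, (hstep k (by omega) (hne k (by omega))).1, Real.mul_self_sqrt hn0.le]
  rwa [hov]

end

/-! ### Convergence in distribution across varying probability spaces. -/

section Distribution

variable {Ω' : Type*} [MeasurableSpace Ω'] {P' : Measure Ω'} [IsProbabilityMeasure P'] {Z : Ω' → ℝ}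

/-- Convergence in distribution only depends on the laws. -/
lemma tendstoInDistribution_of_map_eq {Ω₁ Ω₂ : ℕ → Type*} [∀ n, MeasurableSpace (Ω₁ n)]
    [∀ n, MeasurableSpace (Ω₂ n)] {P₁ : ∀ n, Measure (Ω₁ n)} {P₂ : ∀ n, Measure (Ω₂ n)}
    [∀ n, IsProbabilityMeasure (P₁ n)] [∀ n, IsProbabilityMeasure (P₂ n)]
    {X₁ : ∀ n, Ω₁ n → ℝ} {X₂ : ∀ n, Ω₂ n → ℝ} (h : TendstoInDistribution X₁ atTop Z P₁ P')
    (hX₂ : ∀ n, AEMeasurable (X₂ n) (P₂ n))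
    (hlaw : ∀ᶠ n in atTop, (P₁ n).map (X₁ n) = (P₂ n).map (X₂ n)) :
    TendstoInDistribution X₂ atTop Z P₂ P' where
  forall_aemeasurable := hX₂
  aemeasurable_limit := h.aemeasurable_limit
  tendsto := by
    refine h.tendsto.congr' ?_
    filter_upwards [hlaw] with n hn
    exact Subtype.ext hn

/-- If `X n` tends to `Z` in distribution and `Y n - X n` tends to `0` in probability, then `Y n`
tends to `Z` in distribution; the variables may live on different probability spaces. -/
lemma tendstoInDistribution_of_tendsto_measure_sub {Ω : ℕ → Type*} [∀ n, MeasurableSpace (Ω n)]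
    {P : ∀ n, Measure (Ω n)} [∀ n, IsProbabilityMeasure (P n)] {X Y : ∀ n, Ω n → ℝ}
    (hX : TendstoInDistribution X atTop Z P P') (hY : ∀ n, AEMeasurable (Y n) (P n))
    (hsub : ∀ η > 0, Tendsto (fun n => P n {ω | η ≤ |Y n ω - X n ω|}) atTop (𝓝 0)) :
    TendstoInDistribution Y atTop Z P P' := by
  have hXY : ∀ n, AEMeasurable (fun ω => (X n ω, Y n ω)) (P n) := fun n =>
    (hX.forall_aemeasurable n).prodMk (hY n)
  let R : ℕ → Measure (ℝ × ℝ) := fun n => (P n).map fun ω => (X n ω, Y n ω)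
  have hR : ∀ n, IsProbabilityMeasure (R n) := fun n => Measure.isProbabilityMeasure_map (hXY n)
  -- Independent copies of the pairs (X n, Y n) on one product space make the single-space Slutsky
  -- theorem applicable; only the law of each pair matters.
  let M := Measure.infinitePi R
  have hM : ∀ n, M.map (fun w => w n) = R n := fun n =>
    (measurePreserving_eval_infinitePi R n).map_eq
  have hfst : ∀ n, M.map (fun w => (w n).1) = (P n).map (X n) := by
    intro n
    have : (fun w : ℕ → ℝ × ℝ => (w n).1) = Prod.fst ∘ fun w => w n := rfl
    rw [this, ← Measure.map_map measurable_fst (measurable_pi_apply n), hM,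
      AEMeasurable.map_map_of_aemeasurable measurable_fst.aemeasurable (hXY n)]
    rfl
  have hsnd : ∀ n, M.map (fun w => (w n).2) = (P n).map (Y n) := by
    intro n
    have : (fun w : ℕ → ℝ × ℝ => (w n).2) = Prod.snd ∘ fun w => w n := rfl
    rw [this, ← Measure.map_map measurable_snd (measurable_pi_apply n), hM,
      AEMeasurable.map_map_of_aemeasurable measurable_snd.aemeasurable (hXY n)]
    rfl
  have hX' : TendstoInDistribution (fun n (w : ℕ → ℝ × ℝ) => (w n).1) atTop Z (fun _ => M) P' :=
    tendstoInDistribution_of_map_eq hX (fun n => (measurable_pi_apply n).fst.aemeasurable)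
      (.of_forall fun n => (hfst n).symm)
  have hY' : TendstoInDistribution (fun n (w : ℕ → ℝ × ℝ) => (w n).2) atTop Z (fun _ => M) P' := by
    refine tendstoInDistribution_of_tendstoInMeasure_sub _ _ hX' ?_
      (fun n => (measurable_pi_apply n).snd.aemeasurable)
    rw [tendstoInMeasure_iff_norm]
    intro η hη
    refine (hsub η hη).congr fun n => ?_
    have hms : MeasurableSet {x : ℝ × ℝ | η ≤ |x.2 - x.1|} :=
      measurableSet_le (by fun_prop) (by fun_prop)
    have h1 : M ((fun w => w n) ⁻¹' {x : ℝ × ℝ | η ≤ |x.2 - x.1|}) =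
        P n ((fun ω => (X n ω, Y n ω)) ⁻¹' {x : ℝ × ℝ | η ≤ |x.2 - x.1|}) := by
      rw [← Measure.map_apply (measurable_pi_apply n) hms, hM,
        Measure.map_apply_of_aemeasurable (hXY n) hms]
    simpa using h1.symm
  exact tendstoInDistribution_of_map_eq hY' hY (.of_forall hsnd)

end Distribution

lemma tendsto_zero_of_forall_le {f : ℕ → ENNReal} {a : ℝ}
    (h : ∀ K : ℝ, 0 < K → ∃ g : ℕ → ENNReal, Tendsto g atTop (𝓝 0) ∧
      ∀ᶠ n in atTop, f n ≤ ENNReal.ofReal (a / K ^ 2) + g n) :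
    Tendsto f atTop (𝓝 0) := by
  rw [ENNReal.tendsto_nhds_zero]
  intro ε hε
  have h0 : Tendsto (fun K : ℝ => ENNReal.ofReal (a / K ^ 2)) atTop (𝓝 0) := by
    rw [← ENNReal.ofReal_zero]
    exact ENNReal.tendsto_ofReal (tendsto_const_nhds.div_atTop (tendsto_pow_atTop two_ne_zero))
  have hε2 : 0 < ε / 2 := ENNReal.half_pos hε.ne'
  obtain ⟨K, hK, hK0⟩ :=
    ((ENNReal.tendsto_nhds_zero.1 h0 _ hε2).and (eventually_gt_atTop 0)).exists
  obtain ⟨g, hg, hfg⟩ := h K hK0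
  filter_upwards [hfg, ENNReal.tendsto_nhds_zero.1 hg _ hε2] with n h1 h2
  exact h1.trans ((add_le_add hK h2).trans_eq (ENNReal.add_halves ε))

lemma tendsto_ofReal_div_mul_natCast (C c : ℝ) (hc : 0 < c) :
    Tendsto (fun n : ℕ => ENNReal.ofReal (C / (c * n))) atTop (𝓝 0) := by
  rw [← ENNReal.ofReal_zero]
  exact ENNReal.tendsto_ofReal (tendsto_const_nhds.div_atTop
    (tendsto_natCast_atTop_atTop.const_mul_atTop hc))

/-! ### The initial overlap is asymptotically standard Gaussian. -/

section Initialization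

variable {n : ℕ}

/-- The joint law of the signal and of a Gaussian vector. -/
def gaussianStart (n : ℕ) : Measure (Start n) :=
  (uniformCube n).prod (stdGaussian (EuclideanSpace ℝ (Fin n)))

instance (n : ℕ) : IsProbabilityMeasure (gaussianStart n) := by
  unfold gaussianStart; infer_instance

lemma measurePreserving_gaussianStart (hn : 1 ≤ n) :
    MeasurePreserving (fun p : Start n => (p.1, ‖p.2‖⁻¹ • p.2)) (gaussianStart n)
      ((uniformCube n).prod (uniformSphere n)) := by
  have := isProbabilityMeasure_uniformSphere hn
  have h : MeasurePreserving (fun z : EuclideanSpace ℝ (Fin n) => ‖z‖⁻¹ • z)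
      (stdGaussian _) (uniformSphere n) :=
    ⟨by fun_prop, (uniformSphere_eq_map_stdGaussian hn).symm⟩
  exact (MeasurePreserving.id (uniformCube n)).prod h

/-- Exact for each n ≥ 1: given u, the variance is ‖u‖²/n = 1 whatever u is. -/
lemma map_inner_gaussianStart (hn : 1 ≤ n) :
    (gaussianStart n).map (fun p => inner ℝ p.1 p.2 / √(n : ℝ)) = gaussianReal 0 1 := by
  have hn0 : (0 : ℝ) < n := by exact_mod_cast hn
  have h : MeasurePreserving (fun p : Start n => (p.1, inner ℝ p.1 p.2 / √(n : ℝ)))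
      (gaussianStart n) ((uniformCube n).prod (gaussianReal 0 1)) := by
    refine (MeasurePreserving.id (uniformCube n)).skew_product
      (g := fun u z => inner ℝ u z / √(n : ℝ)) ?_ ?_
    · exact (measurable_fst.inner measurable_snd).div_const _
    · filter_upwards [ae_uniformCube n] with u hu
      have h1 : (fun z => inner ℝ u z / √(n : ℝ)) =
          fun z => inner ℝ ((√(n : ℝ))⁻¹ • u) z := by
        ext z
        rw [real_inner_smul_left, div_eq_inv_mul]
      rw [h1, stdGaussian_map_inner]
      congr 1
      rw [← NNReal.coe_inj]
      push_cast
      rw [norm_smul, mul_pow, hu, norm_inv, Real.norm_of_nonneg (Real.sqrt_nonneg _), inv_pow,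
        Real.sq_sqrt hn0.le, inv_mul_cancel₀ hn0.ne']
  have h2 := (measurePreserving_snd (μ := uniformCube n) (ν := gaussianReal 0 1)).comp h
  exact h2.map_eq

lemma measure_lt_inner_gaussianStart_le (hn : 1 ≤ n) {K : ℝ} (hK : 0 < K) :
    gaussianStart n {p | K < |inner ℝ p.1 p.2 / √(n : ℝ)|} ≤ ENNReal.ofReal (1 / K ^ 2) := by
  have hm : Measurable fun p : Start n => inner ℝ p.1 p.2 / √(n : ℝ) :=
    (measurable_fst.inner measurable_snd).div_const _
  have h := measure_lt_abs_le (gaussianReal 0 1) (f := id) aemeasurable_id hK (B := 1)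
    (by simpa using (lintegral_sq_gaussianReal 1).le)
  rw [← map_inner_gaussianStart hn, Measure.map_apply hm
    (measurableSet_lt measurable_const (by fun_prop))] at h
  exact h

lemma measure_lt_norm_gaussianStart_le {B : ENNReal} {c : ℝ}
    (hB : stdGaussian (EuclideanSpace ℝ (Fin n)) {g | c < |‖g‖ ^ 2 - n|} ≤ B) :
    gaussianStart n {p | c < |‖p.2‖ ^ 2 - n|} ≤ B := by
  have h := (measurePreserving_snd (μ := uniformCube n)
    (ν := stdGaussian (EuclideanSpace ℝ (Fin n)))).measure_preimage
      (s := {g | c < |‖g‖ ^ 2 - n|})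
      (measurableSet_lt (by fun_prop) (by fun_prop)).nullMeasurableSet
  exact h.le.trans hB

lemma abs_div_norm_sub_le (hn : 1 ≤ n) {r a K δ : ℝ} (hr : 0 ≤ r) (hK : |a / √(n : ℝ)| ≤ K)
    (hδ : δ ≤ 1 / 2) (h : |r ^ 2 - n| ≤ δ * n) :
    |a / r - a / √(n : ℝ)| ≤ 2 * K * δ := by
  have hn0 : (0 : ℝ) < n := by exact_mod_cast hn
  have hs : 0 < √(n : ℝ) := Real.sqrt_pos.2 hn0
  set s := √(n : ℝ) with hsdef
  have hss : s ^ 2 = n := Real.sq_sqrt hn0.le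
  rw [← hss] at h
  have h1 : |r - s| ≤ δ * s := by
    have h2 : |r - s| * (r + s) ≤ δ * s ^ 2 := by
      rwa [← abs_of_nonneg (show 0 ≤ r + s by positivity), ← abs_mul,
        show (r - s) * (r + s) = r ^ 2 - s ^ 2 by ring]
    have h3 : |r - s| * s ≤ δ * s * s := by
      nlinarith [abs_nonneg (r - s)]
    exact le_of_mul_le_mul_right h3 hs
  have h2 : s / 2 ≤ r := by
    have := (abs_le.1 h1).1
    nlinarith
  have hr0 : 0 < r := by linarith
  have h3 : a / r - a / s = a / s * ((s - r) / r) := by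
    field_simp
  have h4 : |(s - r) / r| ≤ 2 * δ := by
    rw [abs_div, abs_of_pos hr0, div_le_iff₀ hr0, abs_sub_comm]
    have : 0 ≤ δ := by
      by_contra hcon
      nlinarith [abs_nonneg (r - s)]
    nlinarith
  rw [h3, abs_mul]
  calc |a / s| * |(s - r) / r| ≤ K * (2 * δ) :=
        mul_le_mul hK h4 (abs_nonneg _) ((abs_nonneg _).trans hK)
    _ = _ := by ring

lemma tendstoInDistribution_gaussianStart {Ω' : Type*} [MeasurableSpace Ω'] {P' : Measure Ω'}
    [IsProbabilityMeasure P'] {G : Ω' → ℝ} (hG : HasLaw G (gaussianReal 0 1) P') :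
    TendstoInDistribution (fun (n : ℕ) (p : Start n) => inner ℝ p.1 p.2 / ‖p.2‖) atTop G
      gaussianStart P' := by
  obtain ⟨C, -, hCn⟩ := exists_measure_norm_sq_stdGaussian_le
  have hX : TendstoInDistribution (fun (n : ℕ) (p : Start n) => inner ℝ p.1 p.2 / √(n : ℝ))
      atTop G gaussianStart P' := by
    refine tendstoInDistribution_of_map_eq (P₁ := fun _ => P') (X₁ := fun _ => G)
      (tendstoInDistribution_const hG.aemeasurable) (fun n =>
        ((measurable_fst.inner measurable_snd).div_const _).aemeasurable) ?_
    filter_upwards [eventually_ge_atTop 1] with n hn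
    rw [hG.map_eq, map_inner_gaussianStart hn]
  refine tendstoInDistribution_of_tendsto_measure_sub hX (fun n =>
    ((measurable_fst.inner measurable_snd).div measurable_snd.norm).aemeasurable) fun η hη => ?_
  refine tendsto_zero_of_forall_le (a := 1) fun K hK => ?_
  -- Makes the error 2Kδ of `abs_div_norm_sub_le` at most η/2.
  set δ := min (1 / 2) (η / (4 * K))
  have hδ : 0 < δ := by positivity
  refine ⟨_, tendsto_ofReal_div_mul_natCast C (δ ^ 2) (by positivity), ?_⟩
  filter_upwards [eventually_ge_atTop 1] with n hn
  refine le_trans (measure_mono ?_) ((measure_union_le _ _).trans (add_le_add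
    (measure_lt_inner_gaussianStart_le hn hK)
    (measure_lt_norm_gaussianStart_le (hCn n δ hn hδ))))
  intro p hp
  by_contra hcon
  simp only [Set.mem_union, Set.mem_ofPred_eq, not_or, not_lt] at hcon hp
  have h := abs_div_norm_sub_le hn (norm_nonneg p.2) hcon.1 (min_le_left _ _) hcon.2
  have h2 : 2 * K * δ ≤ η / 2 := by
    calc 2 * K * δ ≤ 2 * K * (η / (4 * K)) := by gcongr; exact min_le_right _ _
      _ = η / 2 := by field_simp; norm_num
  linarith

lemma exists_measure_lt_inner_start_le : ∃ C : ℝ, ∀ n : ℕ, 1 ≤ n → ∀ K : ℝ, 0 < K →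
    ((uniformCube n).prod (uniformSphere n)) {s | 2 * K < |inner ℝ s.2 s.1|} ≤
      ENNReal.ofReal (1 / K ^ 2) + ENNReal.ofReal (C / ((1 / 2) ^ 2 * n)) := by
  obtain ⟨C, -, hCn⟩ := exists_measure_norm_sq_stdGaussian_le
  refine ⟨C, fun n hn K hK => ?_⟩
  have hms : MeasurableSet {s : Start n | 2 * K < |inner ℝ s.2 s.1|} :=
    measurableSet_lt measurable_const
      (continuous_abs.measurable.comp (measurable_snd.inner measurable_fst))
  rw [← (measurePreserving_gaussianStart hn).measure_preimage hms.nullMeasurableSet]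
  refine le_trans (measure_mono ?_) ((measure_union_le _ _).trans (add_le_add
    (measure_lt_inner_gaussianStart_le hn hK)
    (measure_lt_norm_gaussianStart_le (hCn n (1 / 2) hn (by norm_num)))))
  intro p hp
  by_contra hcon
  simp only [Set.mem_union, Set.mem_preimage, Set.mem_ofPred_eq, not_or, not_lt] at hcon hp
  -- With δ = 1/2 the error is at most K, whence the threshold 2K.
  have h := abs_div_norm_sub_le hn (norm_nonneg p.2) hcon.1 le_rfl hcon.2
  rw [real_inner_smul_left, ← div_eq_inv_mul, real_inner_comm] at hp
  have h2 := abs_sub_abs_le_abs_sub (inner ℝ p.1 p.2 / ‖p.2‖) (inner ℝ p.1 p.2 / √(n : ℝ))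
  linarith [hcon.1]

end Initialization

/-! ### The final overlap approximates, in probability, the limit profile at the initial overlap. -/

section

variable {n q : ℕ}

lemma measurePreserving_rearrange (q : ℕ) (hn : 1 ≤ n) :
    MeasurePreserving
      (fun p : EuclideanSpace ℝ (Fin n) × Tensor n q × EuclideanSpace ℝ (Fin n) =>
        (((p.1, p.2.2), p.2.1) : Start n × Tensor n q))
      ((uniformCube n).prod ((gaussianTensor n q).prod (uniformSphere n)))
      (((uniformCube n).prod (uniformSphere n)).prod (gaussianTensor n q)) := by
  have := isProbabilityMeasure_uniformSphere hn
  have h1 := (MeasurePreserving.id (uniformCube n)).prod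
    (Measure.measurePreserving_swap (μ := gaussianTensor n q) (ν := uniformSphere n))
  exact (measurePreserving_prodAssoc (uniformCube n) (uniformSphere n)
    (gaussianTensor n q)).symm.comp h1

/-- The law of signal, initialization and noise. -/
lemma hasLaw_start (hn : 1 ≤ n) {Ω : Type*} [MeasurableSpace Ω] {P : Measure Ω}
    {u x₀ : Ω → EuclideanSpace ℝ (Fin n)} {W : Ω → Tensor n q}
    (h : HasLaw (fun ω => (u ω, W ω, x₀ ω))
      ((uniformCube n).prod ((gaussianTensor n q).prod (uniformSphere n))) P) :
    HasLaw (fun ω => (((u ω, x₀ ω), W ω) : Start n × Tensor n q))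
      (((uniformCube n).prod (uniformSphere n)).prod (gaussianTensor n q)) P := by
  have hmp := measurePreserving_rearrange q hn
  refine ⟨hmp.measurable.comp_aemeasurable h.aemeasurable, ?_⟩
  rw [← hmp.map_eq, ← h.map_eq,
    AEMeasurable.map_map_of_aemeasurable hmp.measurable.aemeasurable h.aemeasurable]
  rfl

lemma measurable_overlap_traj (lam : ℝ) (k : ℕ) :
    Measurable fun p : Start n × Tensor n q => overlap (traj lam p.1 p.2 k) p.1.1 :=
  ((measurable_traj lam k).inner measurable_fst.fst).div_const _

lemma tendsto_measure_overlap {p : ℕ} (hq : 2 ≤ q) (hp : 1 ≤ p) {lam : ℕ → ℝ} {Λ : ℝ}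
    (hlim : Tendsto (fun n : ℕ => lam n / (n : ℝ) ^ (((q : ℝ) - 2 + epsilon q p) / 2))
      atTop (𝓝 Λ)) {η : ℝ} (hη : 0 < η) :
    Tendsto (fun n : ℕ => (((uniformCube n).prod (uniformSphere n)).prod (gaussianTensor n q))
      {z | η ≤ |overlap (traj (lam n) z.1 z.2 p) z.1.1 -
        Real.sin (Real.arctan (Λ ^ geomSum q p * inner ℝ z.1.2 z.1.1 ^ ((q - 1) ^ p)))|})
      atTop (𝓝 0) := by
  obtain ⟨C₁, hC₁⟩ := exists_measure_not_nearIsometry_le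
  obtain ⟨C₂, hC₂⟩ := exists_measure_lt_inner_start_le
  -- One failure term 1/K² for each of the p directions, and one for the initial overlap.
  refine tendsto_zero_of_forall_le (a := p + 1) fun K hK => ?_
  obtain ⟨δ, hδ, hclose⟩ := exists_forall_overlap_close hq hp hlim (K := 2 * K) (by positivity) hη
  refine ⟨fun n => p * (p * ENNReal.ofReal (1 / (δ ^ 2 * n)) + ENNReal.ofReal (C₁ / (δ ^ 2 * n))) +
    ENNReal.ofReal (C₂ / ((1 / 2) ^ 2 * n)), ?_, ?_⟩
  · have h1 := tendsto_ofReal_div_mul_natCast 1 (δ ^ 2) (by positivity)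
    have h2 := tendsto_ofReal_div_mul_natCast C₁ (δ ^ 2) (by positivity)
    have h3 := tendsto_ofReal_div_mul_natCast C₂ ((1 / 2) ^ 2) (by positivity)
    have hpt : (p : ENNReal) ≠ ⊤ := ENNReal.natCast_ne_top p
    have := (ENNReal.Tendsto.const_mul ((ENNReal.Tendsto.const_mul h1 (Or.inr hpt)).add h2)
      (Or.inr hpt)).add h3
    simpa using this
  · filter_upwards [hclose, eventually_ge_atTop 1] with n hn hn1
    have := isProbabilityMeasure_uniformSphere hn1
    set μ := (uniformCube n).prod (uniformSphere n)
    set Q := μ.prod (gaussianTensor n q)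
    have hu : ∀ᵐ s ∂μ, ‖s.1‖ ^ 2 = n :=
      Measure.quasiMeasurePreserving_fst.ae (ae_uniformCube n)
    have hx : ∀ᵐ s ∂μ, ‖s.2‖ = 1 :=
      Measure.quasiMeasurePreserving_snd.ae (ae_norm_uniformSphere n)
    have hae : ∀ᵐ z ∂Q, ‖z.1.1‖ ^ 2 = n ∧ ‖z.1.2‖ = 1 :=
      Measure.quasiMeasurePreserving_fst.ae (hu.and hx)
    have hiso := hC₁ hn1 (by omega : 1 ≤ q) (lam n) p (2 * K) δ (by positivity) hδ μ hu
    have hini : Q {z | 2 * K < |inner ℝ z.1.2 z.1.1|} ≤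
        ENNReal.ofReal (1 / K ^ 2) + ENNReal.ofReal (C₂ / ((1 / 2) ^ 2 * n)) := by
      have hms : MeasurableSet {s : Start n | 2 * K < |inner ℝ s.2 s.1|} :=
        measurableSet_lt measurable_const
          (continuous_abs.measurable.comp (measurable_snd.inner measurable_fst))
      exact ((measurePreserving_fst (μ := μ) (ν := gaussianTensor n q)).measure_preimage
        hms.nullMeasurableSet).le.trans (hC₂ n hn1 K hK)
    have hsub : {z : Start n × Tensor n q | η ≤ |overlap (traj (lam n) z.1 z.2 p) z.1.1 -
        Real.sin (Real.arctan (Λ ^ geomSum q p * inner ℝ z.1.2 z.1.1 ^ ((q - 1) ^ p)))|} ≤ᵐ[Q]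
        ({z | ¬ NearIsometry (lam n) p (2 * K) δ z.1 z.2} ∪
          {z | 2 * K < |inner ℝ z.1.2 z.1.1|} : Set (Start n × Tensor n q)) := by
      filter_upwards [hae] with z hz hbad
      by_contra hcon
      have hcon' : NearIsometry (lam n) p (2 * K) δ z.1 z.2 ∧ |inner ℝ z.1.2 z.1.1| ≤ 2 * K := by
        constructor
        · by_contra h; exact hcon (Or.inl h)
        · by_contra h; exact hcon (Or.inr (not_le.1 h))
      exact absurd (hn z.1 z.2 hcon'.1 hz.1 hz.2 hcon'.2) (not_lt.2 hbad)
    refine (measure_mono_ae hsub).trans ((measure_union_le _ _).trans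
      ((add_le_add hiso hini).trans ?_))
    have hK2 : ENNReal.ofReal (1 / (2 * K) ^ 2) ≤ ENNReal.ofReal (1 / K ^ 2) := by
      apply ENNReal.ofReal_le_ofReal
      apply one_div_le_one_div_of_le (by positivity)
      nlinarith
    have hsum : ENNReal.ofReal ((p + 1 : ℝ) / K ^ 2) =
        p * ENNReal.ofReal (1 / K ^ 2) + ENNReal.ofReal (1 / K ^ 2) := by
      rw [← ENNReal.ofReal_natCast p, ← ENNReal.ofReal_mul (by positivity),
        ← ENNReal.ofReal_add (by positivity) (by positivity)]
      congr 1
      ring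
    rw [hsum, mul_add]
    calc _ ≤ p * ENNReal.ofReal (1 / K ^ 2) +
          p * (p * ENNReal.ofReal (1 / (δ ^ 2 * n)) + ENNReal.ofReal (C₁ / (δ ^ 2 * n))) +
          (ENNReal.ofReal (1 / K ^ 2) + ENNReal.ofReal (C₂ / ((1 / 2) ^ 2 * n))) := by gcongr
      _ = _ := by ring

end

end

end SpikedTensor

/-! ### Conclusion by the continuous mapping theorem and Slutsky. -/

theorem mainTheorem4 (q p : ℕ) (hq : 2 ≤ q) (hp : 1 ≤ p)
    -- the signal-to-noise ratios and their rescaled limit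
    (lam : ℕ → ℝ) (hlam : ∀ n, 1 ≤ n → 0 < lam n) (Λ : ℝ)
    (hlim : Tendsto
      (fun n : ℕ => lam n / (n : ℝ) ^ (((q : ℝ) - 2 + SpikedTensor.epsilon q p) / 2))
      atTop (𝓝 Λ))
    -- for each dimension `n`: independent signal, noise and initialization
    {Ω : ℕ → Type*} [∀ n, MeasurableSpace (Ω n)]
    (P : ∀ n, Measure (Ω n)) [∀ n, IsProbabilityMeasure (P n)]
    (u : ∀ n, Ω n → EuclideanSpace ℝ (Fin n))
    (W : ∀ n, Ω n → SpikedTensor.Tensor n q)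
    (x₀ : ∀ n, Ω n → EuclideanSpace ℝ (Fin n))
    (hlaw : ∀ n, 1 ≤ n → HasLaw (fun ω => (u n ω, W n ω, x₀ n ω))
      ((SpikedTensor.uniformCube n).prod
        ((SpikedTensor.gaussianTensor n q).prod (SpikedTensor.uniformSphere n))) (P n))
    -- a standard Gaussian random variable
    {Ω' : Type*} [MeasurableSpace Ω'] (P' : Measure Ω') [IsProbabilityMeasure P']
    (G : Ω' → ℝ) (hG : HasLaw G (gaussianReal 0 1) P') :
    TendstoInDistribution
      (fun (n : ℕ) (ω : Ω n) => SpikedTensor.overlap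
        (SpikedTensor.powerIteration
          (SpikedTensor.observation (lam n) (u n ω) (W n ω)) (x₀ n ω) p) (u n ω))
      atTop
      (fun ω => Real.sin (Real.arctan
        (Λ ^ (1 / SpikedTensor.epsilon q p) * G ω ^ ((q - 1) ^ p))))
      P P' := by
  open SpikedTensor in
  -- The exponent 1/ε_p is a natural number, so the real power is an ordinary one and the sign of Λ
  -- plays no role.
  have hΛ : Λ ^ (1 / epsilon q p) = Λ ^ geomSum q p := by
    rw [epsilon_eq hq, one_div_one_div, Real.rpow_natCast]
  have htraj : ∀ n (ω : Ω n), powerIteration (observation (lam n) (u n ω) (W n ω)) (x₀ n ω) p =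
      traj (lam n) (u n ω, x₀ n ω) (W n ω) p := fun _ _ => rfl
  rw [hΛ]
  simp only [htraj]
  let F : ℝ → ℝ := fun m => Real.sin (Real.arctan (Λ ^ geomSum q p * m ^ ((q - 1) ^ p)))
  have hF : Continuous F := by fun_prop
  have hstart := fun n (hn : 1 ≤ n) => hasLaw_start hn (hlaw n hn)
  have hinner : ∀ n, Measurable fun z : Start n × Tensor n q => inner ℝ z.1.2 z.1.1 :=
    fun n => measurable_fst.snd.inner measurable_fst.fst
  have hM0 : TendstoInDistribution 
      (fun n (ω : Ω n) => (inner ℝ (x₀ n ω) (u n ω) : ℝ)) atTop G P P' := by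
    refine tendstoInDistribution_of_map_eq (tendstoInDistribution_gaussianStart hG) ?_ ?_
    · intro n
      -- No law is prescribed in dimension 0, where the inner product is constantly 0.
      rcases Nat.eq_zero_or_pos n with rfl | hn
      · simp only [Subsingleton.elim (x₀ 0 _) 0, inner_zero_left]
        exact aemeasurable_const
      · exact (hinner n).comp_aemeasurable (hstart n hn).aemeasurable
    · filter_upwards [eventually_ge_atTop 1] with n hn
      have := isProbabilityMeasure_uniformSphere hn
      have h1 := measurePreserving_gaussianStart hn
      have h2 := measurePreserving_fst
        (μ := (uniformCube n).prod (uniformSphere n)) (ν := gaussianTensor n q)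
      have hm : Measurable fun s : Start n => (inner ℝ s.2 s.1 : ℝ) :=
        measurable_snd.inner measurable_fst
      have h3 : (P n).map (fun ω => inner ℝ (x₀ n ω) (u n ω)) =
          ((uniformCube n).prod (uniformSphere n)).map fun s => (inner ℝ s.2 s.1 : ℝ) := by
        rw [← h2.map_eq, Measure.map_map hm measurable_fst, ← (hstart n hn).map_eq,
          AEMeasurable.map_map_of_aemeasurable (hm.comp measurable_fst).aemeasurable
            (hstart n hn).aemeasurable]
        rfl
      rw [h3, ← h1.map_eq, Measure.map_map hm h1.measurable]
      congr 1
      ext s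
      simp only [Function.comp, real_inner_smul_left, div_eq_inv_mul]
      rw [real_inner_comm]
  have hFM := hM0.continuous_comp hF
  refine tendstoInDistribution_of_tendsto_measure_sub hFM ?_ fun η hη => ?_
  · intro n
    rcases Nat.eq_zero_or_pos n with rfl | hn
    · simp only [overlap, Nat.cast_zero, div_zero]
      exact aemeasurable_const
    · have h := (measurable_overlap_traj (lam n) p).comp_aemeasurable (hstart n hn).aemeasurable
      simpa only [Function.comp_def] using h
  · refine (tendsto_measure_overlap hq hp hlim hη).congr' ?_
    filter_upwards [eventually_ge_atTop 1] with n hn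
    rw [← (hstart n hn).map_eq, Measure.map_apply_of_aemeasurable (hstart n hn).aemeasurable]
    · rfl
    · exact measurableSet_le measurable_const (continuous_abs.measurable.comp
        ((measurable_overlap_traj (lam n) p).sub (hF.measurable.comp (hinner n))))
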